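/- Let $T^2=S^1\times S^1$ with $S^1=\{z\in\mathbb C:|z|=1\}$, and let $\pi\colon\mathbb R^2\to T^2$, $\pi(\theta_1,\theta_2)=(e^{i\theta_1},e^{i\theta_2})$, be its universal covering. A lifting of a map $\Psi\colon T^2\to T^2$ is a continuous map $\widetilde\Psi\colon\mathbb R^2\to\mathbb R^2$ with $\pi\circ\widetilde\Psi=\Psi\circ\pi$. Let $h\colon\mathbb R^2\to\mathbb R$ be real analytic and $2\pi$-periodic in each variable, put $\mu(\theta)=\theta_1+h(\theta)$ for $\theta=(\theta_1,\theta_2)\in\mathbb R^2$, and assume that $d\mu$ vanishes nowhere. Then there is a real analytic diffeomorphism $\Psi$ of $T^2$ with a lifting $\widetilde\Psi$ such that $$\mu\circ\widetilde\Psi(\theta)=\theta_1\qquad\text{for all }\theta\in\mathbb R^2 .$$ Moreover, every analytic circle fibration $\tau\colon T^2\to S^1$, that is, every real analytic submersion with connected fibres, is analytically trivial: there is a real analytic diffeomorphism $\Psi$ of $T^2=S^1\times S^1$ with $\tau(\Psi(z_1,z_2))=z_1$ for all $(z_1,z_2)\in T^2$. -/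

import Mathlib

open scoped Manifold ContDiff

/-- The two-dimensional torus `T² = S¹ × S¹`, with Mathlib's analytic manifold structure on the
unit circle `S¹ ⊆ ℂ` and the product structure. -/
abbrev Torus2 : Type := Circle × Circle

/-- The universal covering `ℝ² → T²`, `(θ₁, θ₂) ↦ (e^{iθ₁}, e^{iθ₂})`. -/
noncomputable def torusCover (θ : ℝ × ℝ) : Torus2 :=
  (Circle.exp θ.1, Circle.exp θ.2)

/-- `F : ℝ² → ℝ²` is a (continuous) lifting of `φ : T² → T²` to the universal covering. -/
def IsTorusLifting (F : ℝ × ℝ → ℝ × ℝ) (φ : Torus2 → Torus2) : Prop :=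
  Continuous F ∧ ∀ θ : ℝ × ℝ, torusCover (F θ) = φ (torusCover θ)

/-- `h` is `2π`-periodic in each of its two variables. -/
def IsTwoPiPeriodic (h : ℝ × ℝ → ℝ) : Prop :=
  ∀ x y : ℝ, h (x + 2 * Real.pi, y) = h (x, y) ∧ h (x, y + 2 * Real.pi) = h (x, y)

/-- An analytic circle fibration `τ : T² → S¹`: a real analytic submersion with connected fibres.
(As `T²` is compact, the fibres are then circles.) -/
structure IsAnalyticCircleFibration (τ : Torus2 → Circle) : Prop where
  analytic : ContMDiff ((𝓡 1).prod (𝓡 1)) (𝓡 1) ω τ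
  submersion : ∀ z : Torus2,
    Function.Surjective (mfderiv ((𝓡 1).prod (𝓡 1)) (𝓡 1) τ z)
  connected_fibre : ∀ w : Circle, IsConnected (τ ⁻¹' {w})

/-- Analytic diffeomorphisms of the torus. -/
abbrev TorusAnalyticDiffeo : Type :=
  Diffeomorph ((𝓡 1).prod (𝓡 1)) ((𝓡 1).prod (𝓡 1)) Torus2 Torus2 ω

/-! Since `μ` has no critical points, its normalised gradient flow retracts the plane onto each
level set, so level sets are connected. Each one is then a single orbit of the Hamiltonian flow. The
level through `x` also contains `x + (0, 2π)`, so no orbit closes up, and the time needed to reach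
that translate has constant sign. With the right orientation the flow climbs, uniformly by
periodicity, and averaging the second coordinate over a long time yields a Lipschitz function that
grows along the flow (`exists_lipschitz_climbing`).

Convolving with powers of a trigonometric bump makes this function analytic without losing the
growth (`exists_contDiff_climbing`). Call the result `ν = θ₂ + k` with `k` periodic. Then `(μ, ν)`
is a bijection of the plane with invertible derivative that commutes with lattice translations. Its
analytic inverse is the required lifting and descends to the torus (`exists_straightening`,
`exists_torusAnalyticDiffeo`).

A fibration lifts to `m = a θ₁ + b θ₂ + periodic`. If `d = gcd(a, b)`, then `τ` has a continuous
`d`-th root, and connectedness of one fibre forces `d = 1` (`gcd_class_eq_one`). A unimodular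
substitution then reduces to the first case. -/

open scoped Manifold ContDiff
open Set Filter Topology MeasureTheory

/-! ### Global flows of bounded Lipschitz vector fields. -/

section Flow

variable {E : Type*} [NormedAddCommGroup E] [NormedSpace ℝ E]

/-- `Φ` is a global flow of the autonomous vector field `V`. -/
structure IsFlow (V : E → E) (Φ : ℝ → E → E) : Prop where
  zero : ∀ x, Φ 0 x = x
  hasDerivAt : ∀ x t, HasDerivAt (fun s => Φ s x) (V (Φ t x)) t

/-- Boundedness lets Picard–Lindelöf run on every interval `(-(n+1), n+1)`, and uniqueness makes
these solutions agree where they overlap. -/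
theorem exists_isFlow [CompleteSpace E] {V : E → E} {K L : NNReal} (hV : LipschitzWith K V)
    (hL : ∀ x, ‖V x‖ ≤ L) : ∃ Φ, IsFlow V Φ := by
  have key : ∀ x : E, ∀ n : ℕ, ∃ α : ℝ → E, α 0 = x ∧
      ∀ t ∈ Ioo (-((n : ℝ) + 1)) ((n : ℝ) + 1), HasDerivAt α (V (α t)) t := by
    intro x n
    have h0 : (0 : ℝ) ∈ Icc (-((n : ℝ) + 1)) ((n : ℝ) + 1) := by
      have : (0 : ℝ) ≤ n := n.cast_nonneg
      constructor <;> linarith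
    have hp : IsPicardLindelof (fun _ : ℝ => V) (⟨0, h0⟩ : Icc (-((n : ℝ) + 1)) ((n : ℝ) + 1)) x
        -- The ball radius is speed times duration, so the solution cannot leave the ball; the
        -- radius `0` means a single initial point.
        (L * (n + 1)) 0 L K := by
      apply IsPicardLindelof.of_time_independent
      · exact fun y _ => hL y
      · exact hV.lipschitzOnWith
      · simp
    obtain ⟨α, h1, h2⟩ := hp.exists_eq_forall_mem_Icc_hasDerivWithinAt₀
    exact ⟨α, h1, fun t ht => (h2 t (Ioo_subset_Icc_self ht)).hasDerivAt (Icc_mem_nhds ht.1 ht.2)⟩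
  choose α hα0 hα using key
  have agree : ∀ x, ∀ m n : ℕ, m ≤ n → ∀ t : ℝ, |t| < m + 1 → α x m t = α x n t := by
    intro x m n hmn t ht
    have hmn' : (m : ℝ) ≤ n := by exact_mod_cast hmn
    have hm : (0 : ℝ) ≤ m := m.cast_nonneg
    refine ODE_solution_unique_of_mem_Ioo (v := fun _ => V) (s := fun _ => univ) (K := K)
      (t₀ := 0) (a := -((m : ℝ) + 1)) (b := (m : ℝ) + 1)
      (fun _ _ => hV.lipschitzOnWith) ⟨by linarith, by linarith⟩
      (fun s hs => ⟨hα x m s hs, trivial⟩)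
      (fun s hs => ⟨hα x n s ⟨by linarith [hs.1], by linarith [hs.2]⟩, trivial⟩) ?_ (abs_lt.1 ht)
    rw [hα0, hα0]
  refine ⟨fun t x => α x ⌊|t|⌋₊ t, fun x => hα0 _ _, fun x t => ?_⟩
  have ht : |t| < (⌊|t|⌋₊ : ℝ) + 1 := Nat.lt_floor_add_one _
  refine (hα x ⌊|t|⌋₊ t (abs_lt.1 ht)).congr_of_eventuallyEq ?_
  filter_upwards [continuous_abs.continuousAt.eventually_lt continuousAt_const ht] with s hs
  refine agree x _ _ ?_ s (Nat.lt_floor_add_one _)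
  have h3 : ⌊|s|⌋₊ < ⌊|t|⌋₊ + 1 := (Nat.floor_lt (abs_nonneg _)).2 (by exact_mod_cast hs)
  omega

namespace IsFlow

variable {V : E → E} {Φ : ℝ → E → E} {K L : NNReal}

theorem neg (h : IsFlow V Φ) : IsFlow (fun x => -V x) (fun t => Φ (-t)) where
  zero x := by simp [h.zero]
  hasDerivAt x t := by
    have := (h.hasDerivAt x (-t)).scomp t (hasDerivAt_neg t)
    simpa [Function.comp_def] using this

theorem continuous_time (h : IsFlow V Φ) (x : E) : Continuous fun t => Φ t x :=
  continuous_iff_continuousAt.2 fun t => (h.hasDerivAt x t).continuousAt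

theorem eq_of_hasDerivAt (h : IsFlow V Φ) (hV : LipschitzWith K V) {γ : ℝ → E} {x : E}
    (hγ0 : γ 0 = x) (hγ : ∀ t, HasDerivAt γ (V (γ t)) t) (t : ℝ) : γ t = Φ t x := by
  have := ODE_solution_unique_univ (v := fun _ => V) (s := fun _ => univ) (K := K) (t₀ := 0)
    (f := γ) (g := fun s => Φ s x) (fun _ => hV.lipschitzOnWith) (fun s => ⟨hγ s, trivial⟩)
    (fun s => ⟨h.hasDerivAt x s, trivial⟩) (by rw [hγ0, h.zero])
  exact congrFun this t

theorem add (h : IsFlow V Φ) (hV : LipschitzWith K V) (s t : ℝ) (x : E) :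
    Φ (s + t) x = Φ s (Φ t x) := by
  refine h.eq_of_hasDerivAt hV (γ := fun s => Φ (s + t) x) (by simp) (fun s => ?_) s
  exact (h.hasDerivAt x (s + t)).comp_add_const s t

theorem neg_apply (h : IsFlow V Φ) (hV : LipschitzWith K V) (t : ℝ) (x : E) :
    Φ (-t) (Φ t x) = x := by
  rw [← h.add hV, neg_add_cancel, h.zero]

theorem translate (h : IsFlow V Φ) (hV : LipschitzWith K V) {v : E} (hv : ∀ x, V (x + v) = V x)
    (t : ℝ) (x : E) : Φ t (x + v) = Φ t x + v := by
  refine (h.eq_of_hasDerivAt hV (γ := fun s => Φ s x + v) (by simp [h.zero]) (fun s => ?_) t).symm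
  rw [hv]
  exact (h.hasDerivAt x s).add_const v

theorem norm_sub_le_time (h : IsFlow V Φ) (hL : ∀ x, ‖V x‖ ≤ L) (s t : ℝ) (x : E) :
    ‖Φ t x - Φ s x‖ ≤ L * |t - s| := by
  have := convex_univ.norm_image_sub_le_of_norm_hasDerivWithin_le (f := fun s => Φ s x)
    (fun u _ => (h.hasDerivAt x u).hasDerivWithinAt) (fun u _ => hL _) (mem_univ s) (mem_univ t)
  simpa using this

theorem dist_le_of_nonneg (h : IsFlow V Φ) (hV : LipschitzWith K V) {t : ℝ} (ht : 0 ≤ t)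
    (x y : E) : dist (Φ t x) (Φ t y) ≤ dist x y * Real.exp (K * t) := by
  have := dist_le_of_trajectories_ODE (v := fun _ => V) (K := K) (f := fun s => Φ s x)
    (g := fun s => Φ s y) (a := 0) (b := t) (δ := dist x y) (fun _ => hV)
    (h.continuous_time x).continuousOn (fun s _ => (h.hasDerivAt x s).hasDerivWithinAt)
    (h.continuous_time y).continuousOn (fun s _ => (h.hasDerivAt y s).hasDerivWithinAt)
    (by simp [h.zero]) t ⟨ht, le_rfl⟩
  simpa using this

theorem dist_le (h : IsFlow V Φ) (hV : LipschitzWith K V) (t : ℝ) (x y : E) :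
    dist (Φ t x) (Φ t y) ≤ dist x y * Real.exp (K * |t|) := by
  rcases le_total 0 t with ht | ht
  · rw [abs_of_nonneg ht]
    exact h.dist_le_of_nonneg hV ht x y
  · have := h.neg.dist_le_of_nonneg (K := K) (LipschitzWith.of_dist_le_mul fun x y => by
      rw [dist_neg_neg]; exact hV.dist_le_mul x y) (neg_nonneg.2 ht) x y
    rw [abs_of_nonpos ht]
    simpa using this

/-- Grönwall controls the space variable and the speed bound controls time. No differentiable
dependence on the initial point is needed: analyticity is recovered later by convolution. -/
theorem continuous (h : IsFlow V Φ) (hV : LipschitzWith K V) (hL : ∀ x, ‖V x‖ ≤ L) :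
    Continuous fun p : ℝ × E => Φ p.1 p.2 := by
  refine continuous_iff_continuousAt.2 fun p => ?_
  refine tendsto_iff_dist_tendsto_zero.2 ?_
  have hlim : Tendsto (fun q : ℝ × E => dist q.2 p.2 * Real.exp (K * |q.1|) + L * |q.1 - p.1|)
      (𝓝 p) (𝓝 0) := by
    have : Continuous
        (fun q : ℝ × E => dist q.2 p.2 * Real.exp (K * |q.1|) + L * |q.1 - p.1|) := by fun_prop
    simpa using this.tendsto p
  refine squeeze_zero (fun _ => dist_nonneg) (fun q => ?_) hlim
  calc dist (Φ q.1 q.2) (Φ p.1 p.2) ≤ dist (Φ q.1 q.2) (Φ q.1 p.2) + dist (Φ q.1 p.2) (Φ p.1 p.2) :=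
        dist_triangle _ _ _
    _ ≤ _ := by
      gcongr
      · exact h.dist_le hV _ _ _
      · rw [dist_eq_norm]
        exact h.norm_sub_le_time hL _ _ _

/-- The velocity changes by at most `K * (L * s)` up to time `s`. This transfers growth along orbits
to growth along tangent segments. -/
theorem norm_sub_sub_smul_le (h : IsFlow V Φ) (hV : LipschitzWith K V) (hL : ∀ x, ‖V x‖ ≤ L)
    {s : ℝ} (hs : 0 ≤ s) (x : E) : ‖Φ s x - x - s • V x‖ ≤ K * L * s ^ 2 := by
  have hd : ∀ u ∈ Icc 0 s, HasDerivWithinAt (fun u => Φ u x - u • V x) (V (Φ u x) - V x)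
      (Icc 0 s) u := fun u _ => by
    have h2 := (hasDerivAt_id' u).smul_const (V x)
    rw [one_smul] at h2
    exact ((h.hasDerivAt x u).sub h2).hasDerivWithinAt
  have hb : ∀ u ∈ Ico 0 s, ‖V (Φ u x) - V x‖ ≤ K * (L * s) := fun u hu => by
    refine (hV.norm_sub_le _ _).trans ?_
    gcongr
    have := h.norm_sub_le_time hL 0 u x
    rw [h.zero, sub_zero, abs_of_nonneg hu.1] at this
    refine this.trans ?_
    gcongr
    exact hu.2.le
  have := norm_image_sub_le_of_norm_deriv_le_segment' hd hb s ⟨hs, le_rfl⟩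
  simp only [h.zero, zero_smul, sub_zero] at this
  calc _ = ‖Φ s x - s • V x - x‖ := by congr 1; abel
    _ ≤ _ := this
    _ = _ := by ring

end IsFlow

end Flow

/-! ### Functions periodic under the lattice, with bounds from compactness. -/

section Lattice

/-- A point of the period lattice `(2πℤ)²`. -/
noncomputable def latticePt (m n : ℤ) : ℝ × ℝ := (2 * Real.pi * m, 2 * Real.pi * n)

/-- `f` is invariant under the lattice `(2πℤ)²`. -/
def LatticePeriodic {X : Type*} (f : ℝ × ℝ → X) : Prop :=
  ∀ (m n : ℤ) (x : ℝ × ℝ), f (x + latticePt m n) = f x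

/-- A closed fundamental domain of the lattice `(2πℤ)²`. -/
def fundSquare : Set (ℝ × ℝ) := Icc 0 (2 * Real.pi) ×ˢ Icc 0 (2 * Real.pi)

theorem isCompact_fundSquare : IsCompact fundSquare := isCompact_Icc.prod isCompact_Icc

theorem exists_add_latticePt_mem (x : ℝ × ℝ) : ∃ m n : ℤ, x + latticePt m n ∈ fundSquare := by
  have key : ∀ t : ℝ, ∃ m : ℤ, t + 2 * Real.pi * m ∈ Icc 0 (2 * Real.pi) := fun t => by
    refine ⟨-toIcoDiv Real.two_pi_pos 0 t, ?_⟩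
    have := toIcoMod_mem_Ico Real.two_pi_pos 0 t
    have h2 := self_sub_toIcoDiv_zsmul Real.two_pi_pos 0 t
    rw [zero_add, ← h2, zsmul_eq_mul] at this
    have h3 := Ico_subset_Icc_self this
    convert h3 using 1
    push_cast
    ring
  obtain ⟨m, hm⟩ := key x.1
  obtain ⟨n, hn⟩ := key x.2
  exact ⟨m, n, hm, hn⟩

theorem IsTwoPiPeriodic.latticePeriodic {h : ℝ × ℝ → ℝ} (hh : IsTwoPiPeriodic h) :
    LatticePeriodic h := by
  intro m n x
  have h1 : ∀ y, Function.Periodic (fun t => h (t, y)) (2 * Real.pi) := fun y t => (hh t y).1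
  have h2 : ∀ t, Function.Periodic (fun y => h (t, y)) (2 * Real.pi) := fun t y => (hh t y).2
  have e1 := (h1 (x.2 + 2 * Real.pi * n)).int_mul m x.1
  have e2 := (h2 x.1).int_mul n x.2
  simp only [mul_comm _ (2 * Real.pi)] at e1 e2
  exact e1.trans e2

namespace LatticePeriodic

theorem exists_norm_le {F : Type*} [NormedAddCommGroup F] {f : ℝ × ℝ → F}
    (hf : LatticePeriodic f) (hc : Continuous f) : ∃ C : NNReal, ∀ x, ‖f x‖ ≤ C := by
  obtain ⟨C, hC⟩ := isCompact_fundSquare.exists_bound_of_continuousOn hc.continuousOn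
  refine ⟨C.toNNReal, fun x => ?_⟩
  obtain ⟨m, n, hmn⟩ := exists_add_latticePt_mem x
  rw [← hf m n x]
  exact (hC _ hmn).trans (Real.le_coe_toNNReal C)

theorem exists_pos_le {f : ℝ × ℝ → ℝ} (hf : LatticePeriodic f) (hc : Continuous f)
    (hpos : ∀ x, 0 < f x) : ∃ δ > 0, ∀ x, δ ≤ f x := by
  obtain ⟨x0, -, h0⟩ := isCompact_fundSquare.exists_isMinOn
    ⟨(0, 0), by constructor <;> simp [Real.pi_pos.le]⟩ hc.continuousOn
  refine ⟨f x0, hpos x0, fun x => ?_⟩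
  obtain ⟨m, n, hmn⟩ := exists_add_latticePt_mem x
  rw [← hf m n x]
  exact h0 hmn

theorem fderiv {F : Type*} [NormedAddCommGroup F] [NormedSpace ℝ F] {f : ℝ × ℝ → F}
    (hf : LatticePeriodic f) : LatticePeriodic (fderiv ℝ f) := by
  intro m n x
  rw [← fderiv_comp_add_right]
  congr 1
  exact funext fun y => hf m n y

theorem exists_lipschitzWith {F : Type*} [NormedAddCommGroup F] [NormedSpace ℝ F]
    {f : ℝ × ℝ → F} (hf : LatticePeriodic f) (hc : ContDiff ℝ 1 f) :
    ∃ C, LipschitzWith C f := by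
  obtain ⟨C, hC⟩ := hf.fderiv.exists_norm_le (hc.continuous_fderiv one_ne_zero)
  exact ⟨C, lipschitzWith_of_nnnorm_fderiv_le (hc.differentiable one_ne_zero) fun x => hC x⟩

end LatticePeriodic

end Lattice

/-! ### Periodic submersions, their Hamiltonian and gradient fields. -/

section Submersion

/-- An analytic function on the plane without critical points that differs from the first
coordinate by a doubly periodic function. -/
structure IsPeriodicSubmersion (μ : ℝ × ℝ → ℝ) : Prop where
  contDiff : ContDiff ℝ ω μ
  periodic : LatticePeriodic fun x => μ x - x.1
  fderiv_ne_zero : ∀ x, fderiv ℝ μ x ≠ 0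

variable {μ : ℝ × ℝ → ℝ}

/-- `±` the Hamiltonian vector field of `μ`. -/
noncomputable def hamField (μ : ℝ × ℝ → ℝ) (σ : ℝ) (x : ℝ × ℝ) : ℝ × ℝ :=
  (-(σ * fderiv ℝ μ x (0, 1)), σ * fderiv ℝ μ x (1, 0))

/-- The gradient of `μ`, normalised so that `μ` grows with unit speed. -/
noncomputable def gradField (μ : ℝ × ℝ → ℝ) (x : ℝ × ℝ) : ℝ × ℝ :=
  (fderiv ℝ μ x (1, 0) / (fderiv ℝ μ x (1, 0) ^ 2 + fderiv ℝ μ x (0, 1) ^ 2),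
    fderiv ℝ μ x (0, 1) / (fderiv ℝ μ x (1, 0) ^ 2 + fderiv ℝ μ x (0, 1) ^ 2))

theorem clm_prod_apply (f : ℝ × ℝ →L[ℝ] ℝ) (v : ℝ × ℝ) :
    f v = v.1 * f (1, 0) + v.2 * f (0, 1) := by
  have : v = v.1 • ((1, 0) : ℝ × ℝ) + v.2 • ((0, 1) : ℝ × ℝ) := by ext <;> simp
  conv_lhs => rw [this, map_add, map_smul, map_smul]
  rfl

namespace IsPeriodicSubmersion

theorem add_latticePt (h : IsPeriodicSubmersion μ) (m n : ℤ) (x : ℝ × ℝ) :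
    μ (x + latticePt m n) = μ x + 2 * Real.pi * m := by
  have := h.periodic m n x
  simp only [Prod.fst_add, latticePt] at this ⊢
  linarith

theorem fderiv_periodic (h : IsPeriodicSubmersion μ) : LatticePeriodic (fderiv ℝ μ) := by
  intro m n x
  rw [← fderiv_comp_add_right]
  simp only [h.add_latticePt]
  exact fderiv_add_const _

theorem sq_add_sq_pos (h : IsPeriodicSubmersion μ) (x : ℝ × ℝ) :
    0 < fderiv ℝ μ x (1, 0) ^ 2 + fderiv ℝ μ x (0, 1) ^ 2 := by
  by_contra hn
  have s1 := sq_nonneg (fderiv ℝ μ x (1, 0))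
  have s2 := sq_nonneg (fderiv ℝ μ x (0, 1))
  have h1 : fderiv ℝ μ x (1, 0) = 0 := pow_eq_zero_iff two_ne_zero |>.1 (by linarith)
  have h2 : fderiv ℝ μ x (0, 1) = 0 := pow_eq_zero_iff two_ne_zero |>.1 (by linarith)
  refine h.fderiv_ne_zero x (ContinuousLinearMap.ext fun v => ?_)
  rw [clm_prod_apply, h1, h2]
  simp

theorem differentiable (h : IsPeriodicSubmersion μ) : Differentiable ℝ μ :=
  h.contDiff.differentiable (by simp)

theorem contDiff_fderiv_apply (h : IsPeriodicSubmersion μ) (v : ℝ × ℝ) :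
    ContDiff ℝ 1 fun x => fderiv ℝ μ x v :=
  (h.contDiff.fderiv_right (m := 1) le_top).clm_apply contDiff_const

theorem contDiff_hamField (h : IsPeriodicSubmersion μ) (σ : ℝ) : ContDiff ℝ 1 (hamField μ σ) :=
  (contDiff_const.mul (h.contDiff_fderiv_apply _)).neg.prodMk
    (contDiff_const.mul (h.contDiff_fderiv_apply _))

theorem contDiff_gradField (h : IsPeriodicSubmersion μ) : ContDiff ℝ 1 (gradField μ) :=
  have h1 := h.contDiff_fderiv_apply (1, 0)
  have h2 := h.contDiff_fderiv_apply (0, 1)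
  (h1.div ((h1.pow 2).add (h2.pow 2)) fun x => (h.sq_add_sq_pos x).ne').prodMk
    (h2.div ((h1.pow 2).add (h2.pow 2)) fun x => (h.sq_add_sq_pos x).ne')

theorem hamField_periodic (h : IsPeriodicSubmersion μ) (σ : ℝ) :
    LatticePeriodic (hamField μ σ) := fun m n x => by
  simp only [hamField, h.fderiv_periodic m n x]

theorem gradField_periodic (h : IsPeriodicSubmersion μ) :
    LatticePeriodic (gradField μ) := fun m n x => by
  simp only [gradField, h.fderiv_periodic m n x]

theorem fderiv_hamField (σ : ℝ) (x : ℝ × ℝ) : fderiv ℝ μ x (hamField μ σ x) = 0 := by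
  rw [clm_prod_apply, hamField]
  ring

theorem fderiv_gradField (h : IsPeriodicSubmersion μ) (x : ℝ × ℝ) :
    fderiv ℝ μ x (gradField μ x) = 1 := by
  rw [clm_prod_apply, gradField]
  have := (h.sq_add_sq_pos x).ne'
  field_simp

/-- In the plane the kernel of `dμ` is spanned by the Hamiltonian vector; Cramer's rule does the
rest, since `ℓ (hamField μ σ x)` is `σ` times the determinant of `(dμ, ℓ)`. -/
theorem eq_zero_of_fderiv_eq_zero (h : IsPeriodicSubmersion μ) {σ : ℝ}
    {x v : ℝ × ℝ} {ℓ : ℝ × ℝ →L[ℝ] ℝ} (hv : fderiv ℝ μ x v = 0) (hℓ : ℓ (hamField μ σ x) ≠ 0)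
    (hℓv : ℓ v = 0) : v = 0 := by
  have hpos := h.sq_add_sq_pos x
  rw [clm_prod_apply] at hv hℓ hℓv
  simp only [hamField] at hℓ
  set a := fderiv ℝ μ x (1, 0)
  set b := fderiv ℝ μ x (0, 1)
  set p := ℓ (1, 0)
  set q := ℓ (0, 1)
  have hd : a * q - b * p ≠ 0 := by
    intro h0
    apply hℓ
    linear_combination σ * h0
  have h1 : v.1 * (a * q - b * p) = 0 := by linear_combination q * hv - b * hℓv
  have h2 : v.2 * (a * q - b * p) = 0 := by linear_combination a * hℓv - p * hv
  ext
  · simpa [hd] using h1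
  · simpa [hd] using h2

end IsPeriodicSubmersion

end Submersion

theorem exists_continuousLinearEquiv_eq {A : ℝ × ℝ →L[ℝ] ℝ × ℝ} (hA : ∀ v, A v = 0 → v = 0) :
    ∃ e : (ℝ × ℝ) ≃L[ℝ] (ℝ × ℝ), (e : ℝ × ℝ →L[ℝ] ℝ × ℝ) = A := by
  have hinj : Function.Injective (A : ℝ × ℝ →ₗ[ℝ] ℝ × ℝ) :=
    (injective_iff_map_eq_zero (A : ℝ × ℝ →ₗ[ℝ] ℝ × ℝ)).2 hA
  refine ⟨(LinearEquiv.ofInjectiveEndo _ hinj).toContinuousLinearEquiv, ?_⟩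
  ext <;> rfl

/-! ### Level sets as orbits of the Hamiltonian flow. -/

namespace IsPeriodicSubmersion

variable {μ : ℝ × ℝ → ℝ} {ψ φ : ℝ → ℝ × ℝ → ℝ × ℝ} {σ : ℝ} {K L : NNReal}

theorem comp_hamFlow (h : IsPeriodicSubmersion μ) (hψ : IsFlow (hamField μ σ) ψ) (t : ℝ)
    (x : ℝ × ℝ) : μ (ψ t x) = μ x := by
  have hd : ∀ s, HasDerivAt (fun s => μ (ψ s x)) 0 s := fun s => by
    have := (h.differentiable (ψ s x)).hasFDerivAt.comp_hasDerivAt s (hψ.hasDerivAt x s)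
    rwa [fderiv_hamField] at this
  have := is_const_of_deriv_eq_zero (fun s => (hd s).differentiableAt) (fun s => (hd s).deriv) t 0
  simpa [hψ.zero] using this

theorem comp_gradFlow (h : IsPeriodicSubmersion μ) (hφ : IsFlow (gradField μ) φ) (t : ℝ)
    (x : ℝ × ℝ) : μ (φ t x) = μ x + t := by
  have hd : ∀ s, HasDerivAt (fun s => μ (φ s x) - s) 0 s := fun s => by
    have := (h.differentiable (φ s x)).hasFDerivAt.comp_hasDerivAt s (hφ.hasDerivAt x s)
    rw [h.fderiv_gradField] at this
    simpa using! this.sub (hasDerivAt_id' s)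
  have := is_const_of_deriv_eq_zero (fun s => (hd s).differentiableAt) (fun s => (hd s).deriv) t 0
  simp only [hφ.zero, sub_zero] at this
  linarith

/-- Flowing `x` along the gradient for time `c - μ x` retracts the connected plane onto the level
set. -/
theorem isPreconnected_level (h : IsPeriodicSubmersion μ) (c : ℝ) :
    IsPreconnected {x | μ x = c} := by
  obtain ⟨K, hK⟩ := h.gradField_periodic.exists_lipschitzWith h.contDiff_gradField
  obtain ⟨L, hL⟩ := h.gradField_periodic.exists_norm_le h.contDiff_gradField.continuous
  obtain ⟨φ, hφ⟩ := exists_isFlow hK hL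
  have hc : Continuous fun x => φ (c - μ x) x :=
    (hφ.continuous hK hL).comp
      ((continuous_const.sub h.contDiff.continuous).prodMk continuous_id)
  have himg : (fun x => φ (c - μ x) x) '' univ = {x | μ x = c} := by
    ext y
    constructor
    · rintro ⟨x, -, rfl⟩
      simp [h.comp_gradFlow hφ]
    · intro hy
      refine ⟨y, trivial, ?_⟩
      simp [show μ y = c from hy, hφ.zero]
  rw [← himg]
  exact isPreconnected_univ.image _ hc.continuousOn

/-- With `ℓ` the pairing with the Hamiltonian vector at `x₀`, the pair `(μ, ℓ)` is a chart near
`x₀`. Flowing moves only the `ℓ` coordinate, so the intermediate value theorem finds a time matching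
`ℓ`, and injectivity of the chart gives equality of points. -/
theorem eventually_exists_hamFlow_eq (h : IsPeriodicSubmersion μ)
    (hψ : IsFlow (hamField μ 1) ψ) (hψc : Continuous fun p : ℝ × (ℝ × ℝ) => ψ p.1 p.2)
    (x₀ : ℝ × ℝ) {ε : ℝ} (hε : 0 < ε) :
    ∀ᶠ p : (ℝ × ℝ) × (ℝ × ℝ) in 𝓝 (x₀, x₀), μ p.1 = μ p.2 → ∃ s, |s| < ε ∧ ψ s p.1 = p.2 := by
  set ℓ : ℝ × ℝ →L[ℝ] ℝ := (-(fderiv ℝ μ x₀ (0, 1))) • ContinuousLinearMap.fst ℝ ℝ ℝ +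
    (fderiv ℝ μ x₀ (1, 0)) • ContinuousLinearMap.snd ℝ ℝ ℝ with hℓ
  have hpos : 0 < ℓ (hamField μ 1 x₀) := by
    have := h.sq_add_sq_pos x₀
    simp only [hℓ, hamField, add_apply, smul_apply,
      ContinuousLinearMap.coe_fst', ContinuousLinearMap.coe_snd', smul_eq_mul]
    nlinarith
  have hG : HasStrictFDerivAt (fun x => (μ x, ℓ x)) ((fderiv ℝ μ x₀).prod ℓ) x₀ :=
    (h.contDiff.contDiffAt.hasStrictFDerivAt (by simp)).prodMk ℓ.hasStrictFDerivAt
  obtain ⟨e, he⟩ := exists_continuousLinearEquiv_eq (A := (fderiv ℝ μ x₀).prod ℓ) fun v hv => by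
    rw [ContinuousLinearMap.prod_apply, Prod.mk_eq_zero] at hv
    exact h.eq_zero_of_fderiv_eq_zero hv.1 hpos.ne' hv.2
  rw [← he] at hG
  set P := hG.toOpenPartialHomeomorph
  have hPs : P.source ∈ 𝓝 x₀ := P.open_source.mem_nhds hG.mem_toOpenPartialHomeomorph_source
  have hcl : Continuous fun p : ℝ × (ℝ × ℝ) => ℓ (hamField μ 1 (ψ p.1 p.2)) :=
    ℓ.continuous.comp ((h.contDiff_hamField 1).continuous.comp hψc)
  have hev : ∀ᶠ p : ℝ × (ℝ × ℝ) in 𝓝 (0, x₀),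
      ψ p.1 p.2 ∈ P.source ∧ 0 < ℓ (hamField μ 1 (ψ p.1 p.2)) := by
    refine (hψc.continuousAt.eventually_mem (by simpa [hψ.zero] using hPs)).and
      (hcl.continuousAt.eventually (lt_mem_nhds ?_))
    simpa [hψ.zero] using hpos
  obtain ⟨r, hr, hball⟩ := Metric.eventually_nhds_iff.1 hev
  set s₁ := min (r / 2) (ε / 2) with hs₁
  have hs₁pos : 0 < s₁ := by positivity
  have hs₁r : s₁ < r := (min_le_left _ _).trans_lt (by linarith)
  have hs₁ε : s₁ < ε := (min_le_right _ _).trans_lt (by linarith)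
  have hin : ∀ y ∈ Metric.ball x₀ r, ∀ s ∈ Icc (-s₁) s₁,
      ψ s y ∈ P.source ∧ 0 < ℓ (hamField μ 1 (ψ s y)) := fun y hy s hs => by
    refine hball (y := (s, y)) ?_
    rw [Prod.dist_eq]
    refine max_lt ?_ hy
    rw [Real.dist_eq, sub_zero]
    exact (abs_le.2 hs).trans_lt hs₁r
  have hderiv : ∀ y s, HasDerivAt (fun s => ℓ (ψ s y)) (ℓ (hamField μ 1 (ψ s y))) s := fun y s =>
    ℓ.hasFDerivAt.comp_hasDerivAt s (hψ.hasDerivAt y s)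
  have hmono : StrictMonoOn (fun s => ℓ (ψ s x₀)) (Icc (-s₁) s₁) := by
    refine strictMonoOn_of_deriv_pos (convex_Icc _ _)
      (fun s _ => (hderiv x₀ s).continuousAt.continuousWithinAt) fun s hs => ?_
    rw [(hderiv x₀ s).deriv]
    exact (hin x₀ (Metric.mem_ball_self hr) s (interior_subset hs)).2
  have hup : ℓ x₀ < ℓ (ψ s₁ x₀) := by
    have := hmono (a := 0) (b := s₁) ⟨by linarith, by linarith⟩ ⟨by linarith, le_rfl⟩ hs₁pos
    simpa [hψ.zero] using this
  have hdown : ℓ (ψ (-s₁) x₀) < ℓ x₀ := by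
    have := hmono (a := -s₁) (b := 0) ⟨le_rfl, by linarith⟩ ⟨by linarith, by linarith⟩
      (by linarith)
    simpa [hψ.zero] using this
  have hct : ∀ s, Continuous fun y => ℓ (ψ s y) := fun s =>
    ℓ.continuous.comp (hψc.comp (continuous_const.prodMk continuous_id))
  have e1 : ∀ᶠ p : (ℝ × ℝ) × (ℝ × ℝ) in 𝓝 (x₀, x₀), ℓ p.2 < ℓ (ψ s₁ p.1) :=
    (ℓ.continuous.comp continuous_snd).continuousAt.eventually_lt
      ((hct s₁).comp continuous_fst).continuousAt hup
  have e2 : ∀ᶠ p : (ℝ × ℝ) × (ℝ × ℝ) in 𝓝 (x₀, x₀), ℓ (ψ (-s₁) p.1) < ℓ p.2 :=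
    ((hct (-s₁)).comp continuous_fst).continuousAt.eventually_lt
      (ℓ.continuous.comp continuous_snd).continuousAt hdown
  have e3 : ∀ᶠ p : (ℝ × ℝ) × (ℝ × ℝ) in 𝓝 (x₀, x₀), p.2 ∈ P.source :=
    continuous_snd.continuousAt.eventually_mem hPs
  have e4 : ∀ᶠ p : (ℝ × ℝ) × (ℝ × ℝ) in 𝓝 (x₀, x₀), p.1 ∈ Metric.ball x₀ r :=
    continuous_fst.continuousAt.eventually_mem (Metric.ball_mem_nhds x₀ hr)
  filter_upwards [e1, e2, e3, e4] with p h1 h2 h3 h4 hμ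
  obtain ⟨s, hs, hsp⟩ := intermediate_value_Icc (f := fun s => ℓ (ψ s p.1)) (a := -s₁) (b := s₁)
    (by linarith) (fun s _ => (hderiv p.1 s).continuousAt.continuousWithinAt) ⟨h2.le, h1.le⟩
  refine ⟨s, (abs_le.2 hs).trans_lt hs₁ε, P.injOn (hin p.1 h4 s hs).1 h3 ?_⟩
  exact Prod.ext ((h.comp_hamFlow hψ s p.1).trans hμ) hsp

/-- Lying on one orbit is an equivalence relation whose classes are open in the level set, which is
connected. -/
theorem exists_hamFlow_eq (h : IsPeriodicSubmersion μ) (hK : LipschitzWith K (hamField μ 1))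
    (hL : ∀ x, ‖hamField μ 1 x‖ ≤ L) (hψ : IsFlow (hamField μ 1) ψ) {x y : ℝ × ℝ}
    (hxy : μ x = μ y) : ∃ t, ψ t x = y := by
  refine (h.isPreconnected_level (μ y)).induction₂ (fun x y => ∃ t, ψ t x = y) ?_ ?_ ?_ hxy rfl
  · intro z hz
    have := (h.eventually_exists_hamFlow_eq hψ (hψ.continuous hK hL) z one_pos)
    rw [nhds_prod_eq] at this
    have h2 := this.curry.self_of_nhds
    filter_upwards [nhdsWithin_le_nhds h2, self_mem_nhdsWithin] with w hw hw'
    obtain ⟨s, -, hs⟩ := hw ((show μ z = μ y from hz).trans (show μ w = μ y from hw').symm)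
    exact ⟨s, hs⟩
  · rintro a b c - - - ⟨s, rfl⟩ ⟨t, rfl⟩
    exact ⟨t + s, hψ.add hK _ _ _⟩
  · rintro a b - - ⟨s, rfl⟩
    exact ⟨-s, hψ.neg_apply hK _ _⟩

/-- A closed orbit would be compact, yet the orbit fills its level set and so contains the unbounded
sequence `x + (0, 2πn)`. -/
theorem hamFlow_injective (h : IsPeriodicSubmersion μ) (hK : LipschitzWith K (hamField μ 1))
    (hL : ∀ x, ‖hamField μ 1 x‖ ≤ L) (hψ : IsFlow (hamField μ 1) ψ) {x : ℝ × ℝ} {t : ℝ}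
    (ht : ψ t x = x) : t = 0 := by
  by_contra hne
  have hper : Function.Periodic (fun s => ψ s x) t := fun s => by
    simp only
    rw [hψ.add hK, ht]
  have hcomp := hper.compact_of_continuous hne (hψ.continuous_time x)
  obtain ⟨C, hC⟩ := hcomp.isBounded.exists_norm_le
  obtain ⟨n, hn⟩ := exists_nat_gt (C + ‖x‖)
  obtain ⟨s, hs⟩ := h.exists_hamFlow_eq hK hL hψ (x := x) (y := x + latticePt 0 n)
    (by rw [h.add_latticePt]; simp)
  have h1 := hC _ ⟨s, rfl⟩
  simp only [hs] at h1
  have h2 : ‖latticePt 0 n‖ ≤ C + ‖x‖ := by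
    calc ‖latticePt 0 n‖ = ‖x + latticePt 0 n - x‖ := by congr 1; abel
      _ ≤ _ := (norm_sub_le _ _).trans (by gcongr)
  have h3 : (n : ℝ) ≤ ‖latticePt 0 n‖ := by
    have : ‖(latticePt 0 n).2‖ ≤ ‖latticePt 0 n‖ := norm_snd_le _
    refine le_trans ?_ this
    simp only [latticePt, Int.cast_natCast, Real.norm_eq_abs]
    rw [abs_of_nonneg (by positivity)]
    nlinarith [Real.pi_gt_three, (n.cast_nonneg : (0 : ℝ) ≤ n)]
  linarith

/-- The time from `x` to `x + (0, 2π)` exists, is unique and is nonzero. Its sign is locally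
constant, hence constant on the plane. -/
theorem hamFlow_sign (h : IsPeriodicSubmersion μ) (hK : LipschitzWith K (hamField μ 1))
    (hL : ∀ x, ‖hamField μ 1 x‖ ≤ L) (hψ : IsFlow (hamField μ 1) ψ) :
    (∀ x, ∃ t > 0, ψ t x = x + latticePt 0 1) ∨ ∀ x, ∃ t < 0, ψ t x = x + latticePt 0 1 := by
  have hcont := hψ.continuous hK hL
  have hlat : latticePt 0 1 ≠ 0 := fun h0 => by
    have : (latticePt 0 1).2 = 0 := by rw [h0]; rfl
    simp [latticePt, Real.pi_ne_zero] at this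
  -- The correction `s` is smaller than `|t|`, so `s + t` keeps the sign of `t`.
  have hloc : ∀ x₀ t, t ≠ 0 → ψ t x₀ = x₀ + latticePt 0 1 →
      ∀ᶠ y in 𝓝 x₀, ∃ s, |s| < |t| ∧ ψ (s + t) y = y + latticePt 0 1 := by
    intro x₀ t ht hx
    have h1 := h.eventually_exists_hamFlow_eq hψ hcont (x₀ + latticePt 0 1) (abs_pos.2 ht)
    have h2 : Tendsto (fun y => (ψ t y, y + latticePt 0 1)) (𝓝 x₀)
        (𝓝 (x₀ + latticePt 0 1, x₀ + latticePt 0 1)) := by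
      have hc : Continuous fun y => (ψ t y, y + latticePt 0 1) :=
        (hcont.comp (continuous_const.prodMk continuous_id)).prodMk
          (continuous_id.add continuous_const)
      have := hc.tendsto x₀
      rwa [hx] at this
    filter_upwards [h2.eventually h1] with y hy
    obtain ⟨s, hs, hsy⟩ := hy (by rw [h.comp_hamFlow hψ, h.add_latticePt]; simp)
    exact ⟨s, hs, by rw [hψ.add hK, hsy]⟩
  have hopen1 : IsOpen {x | ∃ t > 0, ψ t x = x + latticePt 0 1} := by
    refine isOpen_iff_mem_nhds.2 ?_
    rintro x ⟨t, ht, hx⟩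
    filter_upwards [hloc x t ht.ne' hx] with y ⟨s, hs, hsy⟩
    rw [abs_of_pos ht] at hs
    exact ⟨s + t, by linarith [(abs_lt.1 hs).1], hsy⟩
  have hopen2 : IsOpen {x | ∃ t < 0, ψ t x = x + latticePt 0 1} := by
    refine isOpen_iff_mem_nhds.2 ?_
    rintro x ⟨t, ht, hx⟩
    filter_upwards [hloc x t ht.ne hx] with y ⟨s, hs, hsy⟩
    rw [abs_of_neg ht] at hs
    exact ⟨s + t, by linarith [(abs_lt.1 hs).2], hsy⟩
  by_contra hcon
  push Not at hcon
  obtain ⟨⟨x, hx⟩, ⟨y, hy⟩⟩ := hcon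
  have hcover : ∀ z, (∃ t > 0, ψ t z = z + latticePt 0 1) ∨
      ∃ t < 0, ψ t z = z + latticePt 0 1 := fun z => by
    obtain ⟨t, ht⟩ := h.exists_hamFlow_eq hK hL hψ (x := z) (y := z + latticePt 0 1)
      (by rw [h.add_latticePt]; simp)
    rcases lt_trichotomy t 0 with h0 | h0 | h0
    · exact Or.inr ⟨t, h0, ht⟩
    · rw [h0, hψ.zero] at ht
      exact absurd (left_eq_add.1 ht) hlat
    · exact Or.inl ⟨t, h0, ht⟩
  obtain ⟨z, -, ⟨t, ht, hzt⟩, ⟨s, hs, hzs⟩⟩ := isPreconnected_univ _ _ hopen1 hopen2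
    (fun z _ => hcover z)
    ⟨y, trivial, (hcover y).resolve_right fun ⟨t, ht, e⟩ => hy t ht e⟩
    ⟨x, trivial, (hcover x).resolve_left fun ⟨t, ht, e⟩ => hx t ht e⟩
  have : t - s = 0 := h.hamFlow_injective hK hL hψ (x := z) (by
    have := hψ.neg_apply hK s z
    rw [hzs, ← hzt, ← hψ.add hK] at this
    rwa [sub_eq_neg_add])
  linarith

/-- Up to orientation, the Hamiltonian flow of `μ` climbs along each level set of `μ`. -/
theorem exists_upward_hamFlow (h : IsPeriodicSubmersion μ) :
    ∃ (σ : ℝ) (ψ : ℝ → ℝ × ℝ → ℝ × ℝ), IsFlow (hamField μ σ) ψ ∧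
      (∀ x y, μ x = μ y → ∃ t, ψ t x = y) ∧ ∀ x, ∃ t > 0, ψ t x = x + latticePt 0 1 := by
  obtain ⟨K, hK⟩ := (h.hamField_periodic 1).exists_lipschitzWith (h.contDiff_hamField 1)
  obtain ⟨L, hL⟩ := (h.hamField_periodic 1).exists_norm_le (h.contDiff_hamField 1).continuous
  obtain ⟨ψ, hψ⟩ := exists_isFlow hK hL
  rcases h.hamFlow_sign hK hL hψ with hp | hn
  · exact ⟨1, ψ, hψ, fun x y => h.exists_hamFlow_eq hK hL hψ, hp⟩
  · refine ⟨-1, fun t => ψ (-t), ?_, fun x y hxy => ?_, fun x => ?_⟩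
    · convert hψ.neg using 2 with x
      simp [hamField]
    · obtain ⟨t, ht⟩ := h.exists_hamFlow_eq hK hL hψ hxy
      exact ⟨-t, by simpa using ht⟩
    · obtain ⟨t, ht, hx⟩ := hn x
      exact ⟨-t, by linarith, by simpa using hx⟩

end IsPeriodicSubmersion

/-! ### A Lipschitz function growing along the upward flow. -/

namespace IsPeriodicSubmersion

variable {μ : ℝ × ℝ → ℝ} {ψ : ℝ → ℝ × ℝ → ℝ × ℝ} {σ : ℝ} {K L : NNReal}

theorem flow_latticePt (h : IsPeriodicSubmersion μ) (hK : LipschitzWith K (hamField μ σ))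
    (hψ : IsFlow (hamField μ σ) ψ) (t : ℝ) (m n : ℤ) (x : ℝ × ℝ) :
    ψ t (x + latticePt m n) = ψ t x + latticePt m n :=
  hψ.translate hK (h.hamField_periodic σ m n) t x

/-- Some time raises `x` by `2π > 1`; by continuity the same time gains at least `1` near `x`, and
compactness with lattice equivariance bounds the times. -/
theorem exists_uniform_climb (h : IsPeriodicSubmersion μ) (hK : LipschitzWith K (hamField μ σ))
    (hL : ∀ x, ‖hamField μ σ x‖ ≤ L) (hψ : IsFlow (hamField μ σ) ψ)
    (hup : ∀ x, ∃ t > 0, ψ t x = x + latticePt 0 1) :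
    ∃ T₀ > 0, ∀ x, ∃ t, 0 < t ∧ t ≤ T₀ ∧ x.2 + 1 ≤ (ψ t x).2 := by
  have hcont := hψ.continuous hK hL
  have hloc : ∀ x ∈ fundSquare, ∃ U ∈ 𝓝 x, ∃ T > 0, ∀ y ∈ U, y.2 + 1 ≤ (ψ T y).2 := by
    intro x _
    obtain ⟨t, ht, htx⟩ := hup x
    have hlt : x.2 + 1 < (ψ t x).2 := by
      rw [htx]
      simp only [latticePt, Prod.snd_add, Int.cast_one]
      linarith [Real.pi_gt_three]
    have hev : ∀ᶠ y in 𝓝 x, y.2 + 1 < (ψ t y).2 :=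
      (continuous_snd.add continuous_const).continuousAt.eventually_lt
        (continuous_snd.comp
          (hcont.comp (continuous_const.prodMk continuous_id))).continuousAt hlt
    exact ⟨_, hev, t, ht, fun y hy => (show _ < _ from hy).le⟩
  choose! U hU T hT hUT using hloc
  obtain ⟨s, hs, hcov⟩ := isCompact_fundSquare.elim_nhds_subcover U hU
  refine ⟨1 + ∑ x ∈ s, T x, ?_, fun x => ?_⟩
  · have := Finset.sum_nonneg fun x hx => (hT x (hs x hx)).le
    linarith
  · obtain ⟨m, n, hmn⟩ := exists_add_latticePt_mem x
    obtain ⟨z, hz, hxz⟩ := mem_iUnion₂.1 (hcov hmn)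
    refine ⟨T z, hT z (hs z hz), ?_, ?_⟩
    · have := Finset.single_le_sum (f := T) (fun x hx => (hT x (hs x hx)).le) hz
      linarith
    · have := hUT z (hs z hz) _ hxz
      rw [h.flow_latticePt hK hψ] at this
      simp only [Prod.snd_add] at this
      linarith

/-- Climbs of height at least `1`, each lasting at most `T₀`, are chained. The leftover stretch is
shorter than `T₀` and loses at most `L * T₀`. -/
theorem exists_time_climb (h : IsPeriodicSubmersion μ) (hK : LipschitzWith K (hamField μ σ))
    (hL : ∀ x, ‖hamField μ σ x‖ ≤ L) (hψ : IsFlow (hamField μ σ) ψ)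
    (hup : ∀ x, ∃ t > 0, ψ t x = x + latticePt 0 1) :
    ∃ T > 0, ∀ x, x.2 < (ψ T x).2 := by
  obtain ⟨T₀, hT₀, hclimb⟩ := h.exists_uniform_climb hK hL hψ hup
  have hdrop : ∀ t, 0 ≤ t → ∀ x, |(ψ t x).2 - x.2| ≤ L * t := fun t ht x => by
    have h1 := hψ.norm_sub_le_time hL 0 t x
    rw [hψ.zero, sub_zero, abs_of_nonneg ht] at h1
    exact (norm_snd_le (ψ t x - x)).trans h1
  have hLpos : 0 < (L : ℝ) := by
    obtain ⟨t, ht, -, hr⟩ := hclimb 0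
    have := hdrop t ht.le 0
    have h2 := le_abs_self ((ψ t 0).2 - (0 : ℝ × ℝ).2)
    by_contra hn
    have h3 : (L : ℝ) = 0 := le_antisymm (not_lt.1 hn) L.2
    rw [h3] at this
    linarith
  -- The induction terminates because a gain of `1` at speed at most `L` takes a time `t` with `L *
  -- t ≥ 1`.
  have key : ∀ n : ℕ, ∀ T : ℝ, 0 ≤ T → L * T ≤ n → ∀ x,
      T / T₀ - 1 - L * T₀ ≤ (ψ T x).2 - x.2 := by
    intro n
    induction n with
    | zero =>
      intro T hT hTn x
      have : T = 0 := by
        have : (L : ℝ) * T ≤ 0 := by exact_mod_cast hTn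
        nlinarith
      subst this
      have : 0 ≤ (L : ℝ) * T₀ := by positivity
      rw [hψ.zero]
      simp
      linarith
    | succ n ih =>
      intro T hT hTn x
      rcases lt_or_ge T T₀ with hlt | hge
      · have h1 := hdrop T hT x
        have h2 := (abs_le.1 h1).1
        have h3 : (L : ℝ) * T ≤ L * T₀ := by gcongr
        have h4 : T / T₀ ≤ 1 := (div_le_one hT₀).2 hlt.le
        linarith
      · obtain ⟨t, ht, htT, hr⟩ := hclimb x
        have h1 : 1 ≤ L * t := by
          have := (abs_le.1 (hdrop t ht.le x)).2
          linarith
        have h2 := ih (T - t) (by linarith) (by push_cast at hTn; linarith) (ψ t x)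
        rw [← hψ.add hK, sub_add_cancel] at h2
        have h3 : t / T₀ ≤ 1 := (div_le_one hT₀).2 htT
        rw [sub_div] at h2
        linarith
  have hTpos : 0 < T₀ * (2 + L * T₀) := by positivity
  -- For this time the lower bound in `key` equals `1`.
  refine ⟨T₀ * (2 + L * T₀), hTpos, fun x => ?_⟩
  obtain ⟨n, hn⟩ := exists_nat_ge (L * (T₀ * (2 + L * T₀)))
  have := key n _ hTpos.le hn x
  rw [mul_div_cancel_left₀ _ hT₀.ne'] at this
  linarith

/-- Averaging the second coordinate along the flow gives a function that grows along the flow. -/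
theorem exists_lipschitz_climbing (h : IsPeriodicSubmersion μ)
    (hK : LipschitzWith K (hamField μ σ)) (hL : ∀ x, ‖hamField μ σ x‖ ≤ L)
    (hψ : IsFlow (hamField μ σ) ψ) (hup : ∀ x, ∃ t > 0, ψ t x = x + latticePt 0 1) :
    ∃ (ν : ℝ × ℝ → ℝ) (M : NNReal) (δ : ℝ), LipschitzWith M ν ∧
      LatticePeriodic (fun x => ν x - x.2) ∧ 0 < δ ∧
      ∀ x s, 0 ≤ s → δ * s ≤ ν (ψ s x) - ν x := by
  obtain ⟨T, hT, hclimb⟩ := h.exists_time_climb hK hL hψ hup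
  have hcont := hψ.continuous hK hL
  have hct : ∀ x, Continuous fun u => (ψ u x).2 := fun x =>
    continuous_snd.comp (hψ.continuous_time x)
  have hTc : Continuous fun x => (ψ T x).2 - x.2 :=
    (continuous_snd.comp (hcont.comp (continuous_const.prodMk continuous_id))).sub continuous_snd
  obtain ⟨δ, hδ, hδle⟩ := LatticePeriodic.exists_pos_le (f := fun x => (ψ T x).2 - x.2)
    (fun m n x => by
      beta_reduce
      rw [h.flow_latticePt hK hψ]
      simp only [Prod.snd_add]
      ring) hTc (fun x => sub_pos.2 (hclimb x))
  refine ⟨fun x => T⁻¹ * ∫ u in (0 : ℝ)..T, (ψ u x).2, (Real.exp (K * T)).toNNReal, T⁻¹ * δ,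
    ?_, ?_, by positivity, ?_⟩
  · refine LipschitzWith.of_dist_le_mul fun x y => ?_
    rw [Real.coe_toNNReal _ (Real.exp_pos _).le, Real.dist_eq, ← mul_sub,
      ← intervalIntegral.integral_sub ((hct x).intervalIntegrable _ _)
        ((hct y).intervalIntegrable _ _), abs_mul, abs_of_pos (inv_pos.2 hT)]
    have hb : ‖∫ u in (0 : ℝ)..T, ((ψ u x).2 - (ψ u y).2)‖ ≤
        Real.exp (K * T) * dist x y * |T - 0| := by
      refine intervalIntegral.norm_integral_le_of_norm_le_const fun u hu => ?_
      rw [uIoc_of_le hT.le] at hu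
      have h1 : ‖(ψ u x).2 - (ψ u y).2‖ ≤ dist (ψ u x) (ψ u y) := by
        rw [dist_eq_norm]
        exact norm_snd_le (ψ u x - ψ u y)
      refine h1.trans ((hψ.dist_le_of_nonneg hK hu.1.le x y).trans ?_)
      rw [mul_comm]
      gcongr
      exact hu.2
    rw [sub_zero, abs_of_pos hT, Real.norm_eq_abs] at hb
    rw [inv_mul_le_iff₀ hT]
    linarith
  · intro m n x
    have h1 : ∀ u, (ψ u (x + latticePt m n)).2 = (ψ u x).2 + (latticePt m n).2 := fun u => by
      rw [h.flow_latticePt hK hψ]; rfl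
    simp only [h1, Prod.snd_add]
    rw [intervalIntegral.integral_add ((hct x).intervalIntegrable _ _) (by simp)]
    simp
    field_simp
    ring
  · intro x s hs
    have hint : ∀ a b, IntervalIntegrable (fun u => (ψ u x).2) volume a b := fun a b =>
      (hct x).intervalIntegrable _ _
    have hshift : ∀ r, ∫ u in (0 : ℝ)..T, (ψ u (ψ r x)).2 =
        (∫ u in (0 : ℝ)..(r + T), (ψ u x).2) - ∫ u in (0 : ℝ)..r, (ψ u x).2 := fun r => by
      simp only [← hψ.add hK]
      rw [intervalIntegral.integral_comp_add_right (fun u => (ψ u x).2),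
        intervalIntegral.integral_interval_sub_left (hint _ _) (hint _ _), zero_add, add_comm T]
    -- Along an orbit the integral runs over a moving window of length `T`, so its derivative is the
    -- climb over time `T`, which is at least `δ`.
    have hd : ∀ r, HasDerivAt (fun r => ∫ u in (0 : ℝ)..T, (ψ u (ψ r x)).2)
        ((ψ (r + T) x).2 - (ψ r x).2) r := fun r => by
      simp only [hshift]
      refine HasDerivAt.sub ?_ ((hct x).integral_hasStrictDerivAt 0 r).hasDerivAt
      exact ((hct x).integral_hasStrictDerivAt 0 (r + T)).hasDerivAt.comp_add_const r T
    have hmv := (convex_univ).mul_sub_le_image_sub_of_le_deriv (C := δ)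
      (fun r _ => (hd r).continuousAt.continuousWithinAt)
      (fun r _ => (hd r).differentiableAt.differentiableWithinAt)
      (fun r _ => by
        rw [(hd r).deriv, add_comm r T, hψ.add hK]
        exact hδle (ψ r x)) 0 (mem_univ _) s (mem_univ _) hs
    simp only [hψ.zero, sub_zero] at hmv
    rw [← mul_sub, mul_assoc]
    gcongr

end IsPeriodicSubmersion

/-! ### Analytic smoothing by trigonometric polynomials. -/

section Mollify

/-- The closed fundamental square of `(2πℤ)²` centred at the origin. -/
def centredSquare : Set (ℝ × ℝ) := Icc (-Real.pi) Real.pi ×ˢ Icc (-Real.pi) Real.pi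

theorem isCompact_centredSquare : IsCompact centredSquare := isCompact_Icc.prod isCompact_Icc

theorem setIntegral_centredSquare {f : ℝ × ℝ → ℝ} (hf : Continuous f) :
    ∫ y in centredSquare, f y =
      ∫ a in (-Real.pi)..Real.pi, ∫ b in (-Real.pi)..Real.pi, f (a, b) := by
  have hle : -Real.pi ≤ Real.pi := by linarith [Real.pi_pos]
  have hint : IntegrableOn f (Icc (-Real.pi) Real.pi ×ˢ Icc (-Real.pi) Real.pi)
      (volume.prod volume) := hf.continuousOn.integrableOn_compact isCompact_centredSquare
  rw [centredSquare, Measure.volume_eq_prod, setIntegral_prod _ hint,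
    intervalIntegral.integral_of_le hle, integral_Icc_eq_integral_Ioc]
  simp only [intervalIntegral.integral_of_le hle, integral_Icc_eq_integral_Ioc]

theorem intervalIntegral_comp_sub_of_periodic {f : ℝ → ℝ}
    (hf : Function.Periodic f (2 * Real.pi)) (d : ℝ) :
    ∫ a in (-Real.pi)..Real.pi, f (d - a) = ∫ a in (-Real.pi)..Real.pi, f a := by
  rw [intervalIntegral.integral_comp_sub_left]
  have := hf.intervalIntegral_add_eq (d - Real.pi) (-Real.pi)
  convert this using 2 <;> ring

theorem LatticePeriodic.setIntegral_comp_sub {f : ℝ × ℝ → ℝ} (hf : LatticePeriodic f)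
    (hc : Continuous f) (x : ℝ × ℝ) :
    ∫ y in centredSquare, f (x - y) = ∫ y in centredSquare, f y := by
  have hcx : Continuous fun y => f (x - y) := hc.comp (continuous_const.sub continuous_id)
  rw [setIntegral_centredSquare hcx,
    setIntegral_centredSquare hc]
  have h1 : ∀ b, Function.Periodic (fun a => f (a, b)) (2 * Real.pi) := fun b a => by
    simpa [latticePt] using hf 1 0 (a, b)
  have h2 : ∀ a, Function.Periodic (fun b => f (a, b)) (2 * Real.pi) := fun a b => by
    simpa [latticePt] using hf 0 1 (a, b)
  have h3 : Function.Periodic (fun a => ∫ b in (-Real.pi)..Real.pi, f (a, b)) (2 * Real.pi) :=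
    fun a => by
      refine intervalIntegral.integral_congr fun b _ => ?_
      exact h1 b a
  rw [← intervalIntegral_comp_sub_of_periodic h3 x.1]
  refine intervalIntegral.integral_congr fun a _ => ?_
  exact intervalIntegral_comp_sub_of_periodic (h2 (x.1 - a)) x.2

/-- A doubly periodic trigonometric polynomial whose powers concentrate at the lattice points. -/
noncomputable def trigBump (y : ℝ × ℝ) : ℝ := (1 + Real.cos y.1) * (1 + Real.cos y.2)

theorem continuous_trigBump : Continuous trigBump := by
  unfold trigBump
  fun_prop

theorem trigBump_nonneg (y : ℝ × ℝ) : 0 ≤ trigBump y :=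
  mul_nonneg (by linarith [Real.neg_one_le_cos y.1]) (by linarith [Real.neg_one_le_cos y.2])

theorem trigBump_periodic : LatticePeriodic trigBump := fun m n y => by
  simp only [trigBump, latticePt, Prod.fst_add, Prod.snd_add]
  rw [mul_comm (2 * Real.pi) (m : ℝ), mul_comm (2 * Real.pi) (n : ℝ),
    Real.cos_add_int_mul_two_pi, Real.cos_add_int_mul_two_pi]

theorem trigBump_lt {y : ℝ × ℝ} (hy : y ∈ centredSquare) (h0 : y ≠ 0) :
    trigBump y < trigBump 0 := by
  have key : ∀ t ∈ Icc (-Real.pi) Real.pi, t ≠ 0 → Real.cos t < 1 := fun t ht hne =>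
    (Real.cos_le_one t).lt_of_ne fun h1 => hne <|
      (Real.cos_eq_one_iff_of_lt_of_lt (by linarith [ht.1, Real.pi_pos])
        (by linarith [ht.2, Real.pi_pos])).1 h1
  have a1 := Real.neg_one_le_cos y.1
  have a2 := Real.neg_one_le_cos y.2
  have b1 := Real.cos_le_one y.1
  have b2 := Real.cos_le_one y.2
  simp only [trigBump, Prod.fst_zero, Prod.snd_zero, Real.cos_zero]
  by_cases h1 : y.1 = 0
  · have h2 : y.2 ≠ 0 := fun h2 => h0 (Prod.ext h1 h2)
    nlinarith [key y.2 hy.2 h2]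
  · nlinarith [key y.1 hy.1 h1]

/-- A factor `1 + cos (x - y)` separates by the addition formula, so the new integral is a finite
sum of analytic functions of `x` times integrals against `Q`. Allowing every continuous `g` is what
lets this be iterated. -/
theorem contDiff_integral_mul_kernel {Q : ℝ × ℝ → ℝ × ℝ → ℝ}
    (hQ : ∀ x, Continuous (Q x))
    (h : ∀ g : ℝ × ℝ → ℝ, Continuous g →
      ContDiff ℝ ω fun x => ∫ y in centredSquare, g y * Q x y)
    {c s : ℝ × ℝ → ℝ} (hc : ContDiff ℝ ω c) (hs : ContDiff ℝ ω s)
    (g : ℝ × ℝ → ℝ) (hg : Continuous g) :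
    ContDiff ℝ ω fun x => ∫ y in centredSquare, g y * ((1 + c x * c y + s x * s y) * Q x y) := by
  have hint : ∀ x, ∀ f : ℝ × ℝ → ℝ, Continuous f →
      IntegrableOn (fun y => f y * Q x y) centredSquare := fun x f hf =>
    (hf.mul (hQ x)).continuousOn.integrableOn_compact isCompact_centredSquare
  have e : ∀ x, ∫ y in centredSquare, g y * ((1 + c x * c y + s x * s y) * Q x y) =
      (∫ y in centredSquare, g y * Q x y) + c x * (∫ y in centredSquare, (g y * c y) * Q x y) +
        s x * ∫ y in centredSquare, (g y * s y) * Q x y := fun x => by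
    have i1 := hint x g hg
    have i2 := (hint x (fun y => g y * c y) (hg.mul hc.continuous)).const_mul (c x)
    have i3 := (hint x (fun y => g y * s y) (hg.mul hs.continuous)).const_mul (s x)
    have i12 : IntegrableOn (fun y => g y * Q x y + c x * (g y * c y * Q x y)) centredSquare :=
      i1.add i2
    rw [← integral_const_mul, ← integral_const_mul, ← integral_add i1 i2, ← integral_add i12 i3]
    congr 1
    ext y
    ring
  simp only [e]
  exact ((h g hg).add (hc.mul (h _ (hg.mul hc.continuous)))).add
    (hs.mul (h _ (hg.mul hs.continuous)))

theorem contDiff_integral_trigBump_pow (n : ℕ) {g : ℝ × ℝ → ℝ} (hg : Continuous g) :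
    ContDiff ℝ ω fun x => ∫ y in centredSquare, g y * trigBump (x - y) ^ n := by
  induction n generalizing g with
  | zero => simpa using contDiff_const
  | succ n ih =>
    have hcont : ∀ x, Continuous fun y => trigBump (x - y) ^ n := fun x =>
      (continuous_trigBump.comp (continuous_const.sub continuous_id)).pow n
    have h1 := contDiff_integral_mul_kernel (Q := fun x y => trigBump (x - y) ^ n) hcont
      (fun g hg => ih hg) (c := fun x => Real.cos x.2) (s := fun x => Real.sin x.2)
      (Real.contDiff_cos.comp contDiff_snd) (Real.contDiff_sin.comp contDiff_snd)
    have h2 := contDiff_integral_mul_kernel (fun x => by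
        have := hcont x
        fun_prop) h1 (c := fun x => Real.cos x.1) (s := fun x => Real.sin x.1)
      (Real.contDiff_cos.comp contDiff_fst) (Real.contDiff_sin.comp contDiff_fst) g hg
    convert h2 using 6 with x y
    rw [pow_succ', trigBump, Prod.fst_sub, Prod.snd_sub, Real.cos_sub, Real.cos_sub]
    ring

/-- The normalised powers form an approximate identity at the strict maximum `0`; it is tested on
the functions `1` and `‖y‖`. -/
theorem exists_trigBump_concentrated {η : ℝ} (hη : 0 < η) :
    ∃ n : ℕ, 0 < ∫ y in centredSquare, trigBump y ^ n ∧
      (∫ y in centredSquare, trigBump y ^ n * ‖y‖) < η * ∫ y in centredSquare, trigBump y ^ n := by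
  have h00 : (0 : ℝ × ℝ) ∈ closure (interior centredSquare) := by
    refine subset_closure ?_
    rw [centredSquare, interior_prod_eq, interior_Icc]
    constructor <;> simp [Real.pi_pos]
  have hpeak : ∀ g : ℝ × ℝ → ℝ, Continuous g → Tendsto (fun n : ℕ =>
      (∫ y in centredSquare, trigBump y ^ n)⁻¹ • ∫ y in centredSquare, trigBump y ^ n • g y)
      atTop (𝓝 (g 0)) := fun g hg =>
    tendsto_setIntegral_pow_smul_of_unique_maximum_of_isCompact_of_continuousOn
      isCompact_centredSquare continuous_trigBump.continuousOn (fun y hy h0 => trigBump_lt hy h0)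
      (fun y _ => trigBump_nonneg y) (by simp [trigBump]) h00 hg.continuousOn
  -- If the integral vanished, the normalised quotient would be `0` rather than near `1`; hence the
  -- integral is positive.
  have t1 := (hpeak (fun _ => 1) continuous_const).eventually (lt_mem_nhds one_pos)
  have t2 := (hpeak (fun y => ‖y‖) continuous_norm).eventually
    (gt_mem_nhds (show ‖(0 : ℝ × ℝ)‖ < η by simpa using hη))
  obtain ⟨n, h1, h2⟩ := (t1.and t2).exists
  have hI : 0 < ∫ y in centredSquare, trigBump y ^ n := by
    refine lt_of_le_of_ne (integral_nonneg fun y => pow_nonneg (trigBump_nonneg y) n) fun h0 => ?_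
    rw [← h0] at h1
    simp at h1
  refine ⟨n, hI, ?_⟩
  simp only [smul_eq_mul] at h2
  rwa [inv_mul_lt_iff₀ hI, mul_comm] at h2

/-- A Lipschitz function growing along a Lipschitz vector field can be replaced by an analytic one,
keeping its behaviour under lattice translations. -/
theorem exists_contDiff_climbing {Z : ℝ × ℝ → ℝ × ℝ} {ν : ℝ × ℝ → ℝ} {K M : NNReal} {δ C : ℝ}
    (hZ : LipschitzWith K Z) (hν : LipschitzWith M ν) (hper : LatticePeriodic fun x => ν x - x.2)
    (hδ : 0 < δ) (hgrow : ∀ x s, 0 ≤ s → δ * s - C * s ^ 2 ≤ ν (x + s • Z x) - ν x) :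
    ∃ k : ℝ × ℝ → ℝ, ContDiff ℝ ω k ∧ LatticePeriodic k ∧
      ∀ x, 0 < fderiv ℝ (fun x => x.2 + k x) x (Z x) := by
  -- This `η` satisfies `M * K * η ≤ δ / 2`, so smoothing costs at most half the growth; the `+ 1`
  -- avoids a zero denominator.
  obtain ⟨n, hI, hn⟩ := exists_trigBump_concentrated
    (η := δ / (2 * (M * K + 1))) (by positivity)
  set I := ∫ y in centredSquare, trigBump y ^ n with hIdef
  have hk0 : Continuous fun x => ν x - x.2 := hν.continuous.sub continuous_snd
  set k : ℝ × ℝ → ℝ := fun x => I⁻¹ * ∫ y in centredSquare, (ν y - y.2) * trigBump (x - y) ^ n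
    with hk
  have hkeq : ∀ x, k x =
      I⁻¹ * ∫ y in centredSquare, (ν (x - y) - (x - y).2) * trigBump y ^ n := fun x => by
    have hp : LatticePeriodic fun y => (ν y - y.2) * trigBump (x - y) ^ n := fun i j y => by
      have h1 := hper i j y
      have h2 := trigBump_periodic i j (x - (y + latticePt i j))
      simp only at h1 ⊢
      rw [h1, ← h2]
      congr 3
      abel
    have := hp.setIntegral_comp_sub
      (hk0.mul ((continuous_trigBump.comp (continuous_const.sub continuous_id)).pow n)) x
    simp only [sub_sub_cancel] at this
    rw [this]
  have hkan : ContDiff ℝ ω k := contDiff_const.mul (contDiff_integral_trigBump_pow n hk0)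
  refine ⟨k, hkan, fun i j x => ?_, fun x => ?_⟩
  · simp only [hk]
    congr 2
    ext y
    congr 2
    rw [← trigBump_periodic i j (x - y)]
    congr 1
    abel
  · have hpowc : Continuous fun y => trigBump y ^ n := continuous_trigBump.pow n
    have hint : ∀ f : ℝ × ℝ → ℝ, Continuous f →
        IntegrableOn (fun y => f y * trigBump y ^ n) centredSquare := fun f hf =>
      (hf.mul hpowc).continuousOn.integrableOn_compact isCompact_centredSquare
    have hincr : ∀ s : ℝ, 0 ≤ s → (δ / 2) * s - C * s ^ 2 ≤
        ((x + s • Z x).2 + k (x + s • Z x)) - (x.2 + k x) := by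
      intro s hs
      have hνc : ∀ z, Continuous fun y => ν (z - y) := fun z =>
        hν.continuous.comp (continuous_const.sub continuous_id)
      -- The smoothed function is the weighted mean of `ν (z - y) + y.2`, and the terms `y.2` cancel
      -- in increments.
      have hsplit : ∀ z, z.2 + k z =
          I⁻¹ * ∫ y in centredSquare, (ν (z - y) + y.2) * trigBump y ^ n := fun z => by
        have e1 : ∀ y, (ν (z - y) + y.2) * trigBump y ^ n =
            z.2 * trigBump y ^ n + (ν (z - y) - (z - y).2) * trigBump y ^ n := fun y => by
          rw [Prod.snd_sub]; ring
        simp only [e1]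
        rw [integral_add (hint (fun _ => z.2) continuous_const)
          (hint (fun y => ν (z - y) - (z - y).2)
            ((hνc z).sub (continuous_snd.comp (continuous_const.sub continuous_id)))),
          integral_const_mul, hkeq z, ← hIdef]
        field_simp
      have hν2 : ∀ z, IntegrableOn (fun y => (ν (z - y) + y.2) * trigBump y ^ n) centredSquare :=
        fun z => hint _ ((hνc z).add continuous_snd)
      rw [hsplit, hsplit, ← mul_sub, ← integral_sub (hν2 _) (hν2 _)]
      -- The growth hypothesis at `x - y` concerns the direction `Z (x - y)`; replacing it by `Z x`
      -- costs at most `M * K * s * ‖y‖`.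
      have hpt : ∀ y, (δ * s - C * s ^ 2) * trigBump y ^ n -
          M * K * s * (trigBump y ^ n * ‖y‖) ≤
          (ν (x + s • Z x - y) + y.2) * trigBump y ^ n - (ν (x - y) + y.2) * trigBump y ^ n := by
        intro y
        have h1 := hgrow (x - y) s hs
        have h2 : |ν (x + s • Z x - y) - ν (x - y + s • Z (x - y))| ≤ M * (s * (K * ‖y‖)) := by
          rw [← Real.norm_eq_abs]
          refine (hν.norm_sub_le _ _).trans ?_
          gcongr
          have e : x + s • Z x - y - (x - y + s • Z (x - y)) = s • (Z x - Z (x - y)) := by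
            rw [smul_sub]; abel
          rw [e, norm_smul, Real.norm_of_nonneg hs]
          gcongr
          simpa using hZ.norm_sub_le x (x - y)
        have h3 := (abs_le.1 h2).1
        have h4 := pow_nonneg (trigBump_nonneg y) n
        have h5 : δ * s - C * s ^ 2 - M * (s * (K * ‖y‖)) ≤
            ν (x + s • Z x - y) - ν (x - y) := by linarith
        nlinarith [mul_le_mul_of_nonneg_right h5 h4]
      have i1 : IntegrableOn (fun y => (δ * s - C * s ^ 2) * trigBump y ^ n) centredSquare :=
        hint _ continuous_const
      have i2 : IntegrableOn (fun y => M * K * s * (trigBump y ^ n * ‖y‖)) centredSquare :=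
        (continuous_const.mul
          (hpowc.mul continuous_norm)).continuousOn.integrableOn_compact isCompact_centredSquare
      have hmono := integral_mono (i1.sub i2) ((hν2 (x + s • Z x)).sub (hν2 x)) hpt
      simp only [Pi.sub_apply] at hmono
      rw [integral_sub i1 i2, integral_const_mul, integral_const_mul, ← hIdef] at hmono
      rw [le_inv_mul_iff₀ hI]
      refine le_trans ?_ hmono
      have h6 : (M : ℝ) * K * s * (∫ y in centredSquare, trigBump y ^ n * ‖y‖) ≤
          M * K * s * (δ / (2 * (M * K + 1)) * I) := by gcongr
      have h7 : (M : ℝ) * K * (δ / (2 * (M * K + 1))) ≤ δ / 2 := by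
        rw [mul_div_assoc', div_le_div_iff₀ (by positivity) two_pos]
        nlinarith
      have h8 := mul_le_mul_of_nonneg_right h7 (mul_nonneg hs hI.le)
      nlinarith
    have hdiff : DifferentiableAt ℝ (fun x : ℝ × ℝ => x.2 + k x) x :=
      differentiableAt_snd.add (hkan.differentiable (by simp) x)
    have hline : HasDerivAt (fun s : ℝ => x + s • Z x) (Z x) 0 := by
      have := ((hasDerivAt_id' (0 : ℝ)).smul_const (Z x)).const_add x
      rwa [one_smul] at this
    have hd : HasDerivAt (fun s : ℝ => (x + s • Z x).2 + k (x + s • Z x))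
        (fderiv ℝ (fun x => x.2 + k x) x (Z x)) 0 := by
      refine HasFDerivAt.comp_hasDerivAt (f := fun s : ℝ => x + s • Z x)
        (l := fun x : ℝ × ℝ => x.2 + k x) 0 ?_ hline
      rw [zero_smul, add_zero]
      exact hdiff.hasFDerivAt
    refine (half_pos hδ).trans_le ?_
    have hslope := hd.tendsto_slope_zero_right
    have hlow : Tendsto (fun s : ℝ => δ / 2 - C * s) (𝓝[>] 0) (𝓝 (δ / 2)) := by
      have : Continuous fun s : ℝ => δ / 2 - C * s := by fun_prop
      simpa using (this.tendsto 0).mono_left nhdsWithin_le_nhds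
    refine le_of_tendsto_of_tendsto hlow hslope ?_
    filter_upwards [self_mem_nhdsWithin] with s hs
    have hs' : 0 < s := hs
    have := hincr s hs'.le
    simp only [zero_add, zero_smul, add_zero, smul_eq_mul]
    rw [le_inv_mul_iff₀ hs']
    calc s * (δ / 2 - C * s) = δ / 2 * s - C * s ^ 2 := by ring
      _ ≤ _ := this

end Mollify

/-! ### Straightening a periodic submersion. -/

theorem IsPeriodicSubmersion.exists_conjugate {μ : ℝ × ℝ → ℝ} (h : IsPeriodicSubmersion μ) :
    ∃ (σ : ℝ) (ψ : ℝ → ℝ × ℝ → ℝ × ℝ) (k : ℝ × ℝ → ℝ), IsFlow (hamField μ σ) ψ ∧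
      (∀ x y, μ x = μ y → ∃ t, ψ t x = y) ∧ ContDiff ℝ ω k ∧ LatticePeriodic k ∧
      ∀ x, 0 < fderiv ℝ (fun x => x.2 + k x) x (hamField μ σ x) := by
  obtain ⟨σ, ψ, hψ, hlev, hup⟩ := h.exists_upward_hamFlow
  obtain ⟨K, hK⟩ := (h.hamField_periodic σ).exists_lipschitzWith (h.contDiff_hamField σ)
  obtain ⟨L, hL⟩ := (h.hamField_periodic σ).exists_norm_le (h.contDiff_hamField σ).continuous
  obtain ⟨ν, M, δ, hν, hper, hδ, hgrow⟩ := h.exists_lipschitz_climbing hK hL hψ hup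
  -- The constant `C` is the Lipschitz constant of `ν` times the quadratic error between an orbit
  -- and its tangent.
  obtain ⟨k, hk, hkper, hpos⟩ := exists_contDiff_climbing (C := M * (K * L)) hK hν hper hδ
    fun x s hs => by
      have h1 := hgrow x s hs
      have h2 := hν.norm_sub_le (ψ s x) (x + s • hamField μ σ x)
      have h3 := hψ.norm_sub_sub_smul_le hK hL hs x
      rw [sub_sub] at h3
      have h4 : (M : ℝ) * ‖ψ s x - (x + s • hamField μ σ x)‖ ≤ M * (K * L * s ^ 2) := by gcongr
      have h5 := (le_abs_self _).trans (h2.trans h4)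
      linarith
  exact ⟨σ, ψ, k, hψ, hlev, hk, hkper, hpos⟩

/-- The inverse of a bijective analytic self-map of the plane with invertible derivative is
analytic. -/
theorem contDiff_of_rightInverse {F G : ℝ × ℝ → ℝ × ℝ} (hG : ContDiff ℝ ω G)
    (hd : ∀ x v, fderiv ℝ G x v = 0 → v = 0) (hFG : Function.LeftInverse F G)
    (hGF : Function.RightInverse F G) : ContDiff ℝ ω F := by
  refine contDiff_iff_contDiffAt.2 fun y => ?_
  obtain ⟨e, he⟩ := exists_continuousLinearEquiv_eq (hd (F y))
  have hder : HasFDerivAt G (e : ℝ × ℝ →L[ℝ] ℝ × ℝ) (F y) := by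
    rw [he]
    exact (hG.differentiable (by simp) _).hasFDerivAt
  have hat : ContDiffAt ℝ ω G (F y) := hG.contDiffAt
  have hstrict := hat.hasStrictFDerivAt' hder (by simp)
  have hloc := hat.to_localInverse hder (by simp)
  rw [hGF y] at hloc
  refine hloc.congr_of_eventuallyEq ?_
  have hev := hstrict.eventually_right_inverse
  rw [hGF y] at hev
  filter_upwards [hev] with z hz
  rw [← hFG (hat.localInverse hder (by simp) z)]
  exact congrArg F hz.symm

namespace IsPeriodicSubmersion

theorem surjective_fst {μ : ℝ × ℝ → ℝ} (h : IsPeriodicSubmersion μ) : Function.Surjective μ := by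
  intro c
  obtain ⟨C, hC⟩ := h.periodic.exists_norm_le (h.contDiff.continuous.sub continuous_fst)
  refine mem_range_of_exists_le_of_exists_ge h.contDiff.continuous
    ⟨(c - C, 0), ?_⟩ ⟨(c + C, 0), ?_⟩
  · have := (abs_le.1 (hC (c - C, 0))).2
    simp only at this
    linarith
  · have := (abs_le.1 (hC (c + C, 0))).1
    simp only at this
    linarith

/-- A periodic submersion becomes the first coordinate after an analytic change of coordinates of
the plane commuting with the period lattice. -/
theorem exists_straightening {μ : ℝ × ℝ → ℝ} (h : IsPeriodicSubmersion μ) :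
    ∃ F G : ℝ × ℝ → ℝ × ℝ, ContDiff ℝ ω F ∧ ContDiff ℝ ω G ∧
      Function.LeftInverse F G ∧ Function.RightInverse F G ∧
      (∀ m n x, F (x + latticePt m n) = F x + latticePt m n) ∧
      (∀ m n x, G (x + latticePt m n) = G x + latticePt m n) ∧ ∀ x, μ (F x) = x.1 := by
  obtain ⟨σ, ψ, k, hψ, hlev, hk, hkper, hpos⟩ := h.exists_conjugate
  set ν : ℝ × ℝ → ℝ := fun x => x.2 + k x with hν
  have hνan : ContDiff ℝ ω ν := contDiff_snd.add hk
  have hνlat : ∀ m n x, ν (x + latticePt m n) = ν x + 2 * Real.pi * n := fun m n x => by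
    have h1 : ν (x + latticePt m n) = (x + latticePt m n).2 + k (x + latticePt m n) := rfl
    rw [h1, hkper m n x, Prod.snd_add, latticePt, hν]
    ring
  have hνper : LatticePeriodic (fderiv ℝ ν) := fun m n x => by
    rw [← fderiv_comp_add_right]
    simp only [hνlat]
    exact fderiv_add_const _
  obtain ⟨δ, hδ, hδle⟩ := LatticePeriodic.exists_pos_le
    (f := fun x => fderiv ℝ ν x (hamField μ σ x))
    (fun m n x => by
      beta_reduce
      rw [hνper m n x, h.hamField_periodic σ m n x])
    ((hνan.continuous_fderiv (by simp)).clm_apply (h.contDiff_hamField σ).continuous) hpos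
  have hd : ∀ x t, HasDerivAt (fun t => ν (ψ t x))
      (fderiv ℝ ν (ψ t x) (hamField μ σ (ψ t x))) t := fun x t =>
    (hνan.differentiable (by simp) (ψ t x)).hasFDerivAt.comp_hasDerivAt (f := fun t => ψ t x) t
      (hψ.hasDerivAt x t)
  have hgrow : ∀ x s t, s ≤ t → δ * (t - s) ≤ ν (ψ t x) - ν (ψ s x) := fun x s t hst =>
    convex_univ.mul_sub_le_image_sub_of_le_deriv (f := fun t => ν (ψ t x))
      (fun r _ => (hd x r).continuousAt.continuousWithinAt)
      (fun r _ => (hd x r).differentiableAt.differentiableWithinAt)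
      (fun r _ => by rw [(hd x r).deriv]; exact hδle _) s (mem_univ _) t (mem_univ _) hst
  set G : ℝ × ℝ → ℝ × ℝ := fun x => (μ x, ν x) with hG
  have hGan : ContDiff ℝ ω G := h.contDiff.prodMk hνan
  -- Points with equal `μ` lie on one orbit, along which `ν` grows at rate at least `δ`. This gives
  -- injectivity, and then surjectivity, of `(μ, ν)`.
  have hinj : Function.Injective G := by
    intro x y hxy
    obtain ⟨t, rfl⟩ := hlev x y (congrArg Prod.fst hxy)
    have h2 : ν x = ν (ψ t x) := congrArg Prod.snd hxy
    have h0 : t = 0 := by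
      rcases le_total 0 t with ht | ht
      · have := hgrow x 0 t ht
        rw [hψ.zero] at this
        nlinarith
      · have := hgrow x t 0 ht
        rw [hψ.zero] at this
        nlinarith
    rw [h0, hψ.zero]
  have hsurj : Function.Surjective G := by
    rintro ⟨c, b⟩
    obtain ⟨x, hx⟩ := h.surjective_fst c
    obtain ⟨t, ht⟩ : b ∈ range fun t => ν (ψ t x) := by
      have hc : Continuous fun t => ν (ψ t x) :=
        continuous_iff_continuousAt.2 fun t => (hd x t).continuousAt
      have hr : δ * (|b - ν x| / δ) = |b - ν x| := mul_div_cancel₀ _ hδ.ne'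
      have hnn : 0 ≤ |b - ν x| / δ := by positivity
      refine mem_range_of_exists_le_of_exists_ge hc ⟨-(|b - ν x| / δ), ?_⟩ ⟨|b - ν x| / δ, ?_⟩
      · have := hgrow x (-(|b - ν x| / δ)) 0 (by linarith)
        rw [hψ.zero, zero_sub, neg_neg, hr] at this
        linarith [neg_abs_le (b - ν x)]
      · have := hgrow x 0 (|b - ν x| / δ) hnn
        rw [hψ.zero, sub_zero, hr] at this
        linarith [le_abs_self (b - ν x)]
    exact ⟨ψ t x, Prod.ext ((h.comp_hamFlow hψ t x).trans hx) ht⟩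
  set e := Equiv.ofBijective G ⟨hinj, hsurj⟩
  have hFG : Function.LeftInverse e.symm G := e.symm_apply_apply
  have hGF : Function.RightInverse e.symm G := e.apply_symm_apply
  have hGlat : ∀ m n x, G (x + latticePt m n) = G x + latticePt m n := fun m n x => by
    simp only [hG, hνlat, h.add_latticePt]
    rfl
  have hGd : ∀ x v, fderiv ℝ G x v = 0 → v = 0 := fun x v hv => by
    have e1 : fderiv ℝ G x = (fderiv ℝ μ x).prod (fderiv ℝ ν x) :=
      ((h.differentiable x).hasFDerivAt.prodMk
        (hνan.differentiable (by simp) x).hasFDerivAt).fderiv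
    rw [e1, ContinuousLinearMap.prod_apply, Prod.mk_eq_zero] at hv
    exact h.eq_zero_of_fderiv_eq_zero hv.1 (hpos x).ne' hv.2
  refine ⟨e.symm, G, contDiff_of_rightInverse hGan hGd hFG hGF, hGan, hFG, hGF, fun m n x => ?_,
    hGlat, fun x => congrArg Prod.fst (hGF x)⟩
  apply hinj
  rw [hGF, hGlat, hGF]

end IsPeriodicSubmersion

/-! ### Local sections of the covering and descent to the torus. -/

section Cover

/-- The branch near `Circle.exp t₀` of the logarithm on the circle taking the value `t₀` there. -/
noncomputable def circleLog (t₀ : ℝ) (z : Circle) : ℝ :=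
  Complex.arg (z / Circle.exp t₀ : Circle) + t₀

theorem exp_circleLog (t₀ : ℝ) (z : Circle) : Circle.exp (circleLog t₀ z) = z := by
  rw [circleLog, Circle.exp_add, Circle.exp_arg, div_mul_cancel]

theorem circleLog_exp {t₀ t : ℝ} (h : |t - t₀| < Real.pi) : circleLog t₀ (Circle.exp t) = t := by
  rw [circleLog, ← Circle.exp_sub, Circle.arg_exp (abs_lt.1 h).1 (abs_lt.1 h).2.le, sub_add_cancel]

theorem contMDiffAt_circleLog (t₀ : ℝ) :
    ContMDiffAt (𝓡 1) 𝓘(ℝ, ℝ) ω (circleLog t₀) (Circle.exp t₀) := by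
  have hlog : ContDiffAt ℝ ω Complex.arg 1 := by
    have h1 : ContDiffAt ℝ ω Complex.log 1 :=
      (Complex.contDiffAt_log (n := ω) Complex.one_mem_slitPlane).restrict_scalars ℝ
    have h2 := Complex.imCLM.contDiff.contDiffAt.comp (1 : ℂ) h1
    refine h2.congr_of_eventuallyEq (Eventually.of_forall fun z => ?_)
    exact (Complex.log_im z).symm
  have := finrank_real_complex_fact'
  have hcoe : ContMDiff (𝓡 1) 𝓘(ℝ, ℂ) ω fun z : Circle => (z : ℂ) := contMDiff_coe_sphere
  have hdiv : ContMDiff (𝓡 1) 𝓘(ℝ, ℂ) ω fun z : Circle => ((z / Circle.exp t₀ : Circle) : ℂ) :=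
    hcoe.comp (contMDiff_id.div contMDiff_const)
  have harg : ContMDiffAt (𝓡 1) 𝓘(ℝ, ℝ) ω
      (fun z : Circle => Complex.arg (z / Circle.exp t₀ : Circle)) (Circle.exp t₀) := by
    refine ContMDiffAt.comp (Circle.exp t₀) (g := Complex.arg) (I' := 𝓘(ℝ, ℂ)) ?_ hdiv.contMDiffAt
    rw [div_self', Circle.coe_one]
    exact hlog.contMDiffAt
  exact harg.add contMDiffAt_const

/-- The local section of the universal covering of the torus through `x₀`. -/
noncomputable def torusSection (x₀ : ℝ × ℝ) (z : Torus2) : ℝ × ℝ :=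
  (circleLog x₀.1 z.1, circleLog x₀.2 z.2)

theorem torusCover_torusSection (x₀ : ℝ × ℝ) (z : Torus2) :
    torusCover (torusSection x₀ z) = z :=
  Prod.ext (exp_circleLog _ _) (exp_circleLog _ _)

theorem torusSection_torusCover (x₀ : ℝ × ℝ) : torusSection x₀ (torusCover x₀) = x₀ :=
  Prod.ext (circleLog_exp (by simp [Real.pi_pos])) (circleLog_exp (by simp [Real.pi_pos]))

theorem contMDiffAt_torusSection (x₀ : ℝ × ℝ) :
    ContMDiffAt ((𝓡 1).prod (𝓡 1)) 𝓘(ℝ, ℝ × ℝ) ω (torusSection x₀) (torusCover x₀) := by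
  have h1 : ContMDiffAt ((𝓡 1).prod (𝓡 1)) 𝓘(ℝ, ℝ) ω
      (fun z : Torus2 => circleLog x₀.1 z.1) (torusCover x₀) :=
    ContMDiffAt.comp (torusCover x₀) (g := circleLog x₀.1) (I' := 𝓡 1)
      (contMDiffAt_circleLog x₀.1) contMDiffAt_fst
  have h2 : ContMDiffAt ((𝓡 1).prod (𝓡 1)) 𝓘(ℝ, ℝ) ω
      (fun z : Torus2 => circleLog x₀.2 z.2) (torusCover x₀) :=
    ContMDiffAt.comp (torusCover x₀) (g := circleLog x₀.2) (I' := 𝓡 1)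
      (contMDiffAt_circleLog x₀.2) contMDiffAt_snd
  exact h1.prodMk_space h2

theorem contMDiff_torusCover :
    ContMDiff 𝓘(ℝ, ℝ × ℝ) ((𝓡 1).prod (𝓡 1)) ω torusCover :=
  (contMDiff_circleExp.comp contDiff_fst.contMDiff).prodMk
    (contMDiff_circleExp.comp contDiff_snd.contMDiff)

theorem circleExp_add_two_pi_mul_int (t : ℝ) (m : ℤ) :
    Circle.exp (t + 2 * Real.pi * m) = Circle.exp t :=
  Circle.exp_eq_exp.2 ⟨m, by ring⟩

theorem torusCover_add_latticePt (m n : ℤ) (x : ℝ × ℝ) :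
    torusCover (x + latticePt m n) = torusCover x :=
  Prod.ext (circleExp_add_two_pi_mul_int _ _) (circleExp_add_two_pi_mul_int _ _)

theorem torusCover_eq_iff {x y : ℝ × ℝ} :
    torusCover x = torusCover y ↔ ∃ m n : ℤ, x = y + latticePt m n := by
  constructor
  · intro h
    obtain ⟨m, hm⟩ := Circle.exp_eq_exp.1 (congrArg Prod.fst h)
    obtain ⟨n, hn⟩ := Circle.exp_eq_exp.1 (congrArg Prod.snd h)
    exact ⟨m, n, Prod.ext (by rw [hm, mul_comm]; rfl) (by rw [hn, mul_comm]; rfl)⟩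
  · rintro ⟨m, n, rfl⟩
    exact torusCover_add_latticePt m n y

/-- The map induced on the torus by a map of the plane. -/
noncomputable def torusDescend {X : Type*} (f : ℝ × ℝ → X) (z : Torus2) : X :=
  f (torusSection 0 z)

theorem torusDescend_torusCover {X : Type*} {f : ℝ × ℝ → X} (hf : LatticePeriodic f)
    (x : ℝ × ℝ) : torusDescend f (torusCover x) = f x := by
  obtain ⟨m, n, h⟩ := torusCover_eq_iff.1 (torusCover_torusSection 0 (torusCover x))
  rw [torusDescend, h, hf m n x]

/-- The section in the definition need not be analytic everywhere; periodicity permits a section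
analytic at the point under study. -/
theorem torusDescend_eq {X : Type*} {f : ℝ × ℝ → X} (hf : LatticePeriodic f) (x₀ : ℝ × ℝ) :
    torusDescend f = fun z => f (torusSection x₀ z) := by
  ext z
  rw [← torusDescend_torusCover hf, torusCover_torusSection]

theorem continuous_torusDescend {X : Type*} [TopologicalSpace X] {f : ℝ × ℝ → X}
    (hf : LatticePeriodic f) (hc : Continuous f) : Continuous (torusDescend f) := by
  refine continuous_iff_continuousAt.2 fun z => ?_
  have hz := torusCover_torusSection 0 z
  set x := torusSection 0 z
  rw [torusDescend_eq hf x, ← hz]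
  exact hc.continuousAt.comp (contMDiffAt_torusSection x).continuousAt

theorem contMDiff_torusDescend {f : ℝ × ℝ → Torus2} (hf : LatticePeriodic f)
    (hc : ContMDiff 𝓘(ℝ, ℝ × ℝ) ((𝓡 1).prod (𝓡 1)) ω f) :
    ContMDiff ((𝓡 1).prod (𝓡 1)) ((𝓡 1).prod (𝓡 1)) ω (torusDescend f) := by
  intro z
  have hz := torusCover_torusSection 0 z
  set x := torusSection 0 z
  rw [torusDescend_eq hf x, ← hz]
  exact hc.contMDiffAt.comp (torusCover x) (contMDiffAt_torusSection x)

/-- Mutually inverse analytic self-maps of the plane that respect the period lattice induce an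
analytic diffeomorphism of the torus. -/
theorem exists_torusAnalyticDiffeo {F G : ℝ × ℝ → ℝ × ℝ} (hF : ContDiff ℝ ω F)
    (hG : ContDiff ℝ ω G) (hFG : Function.LeftInverse F G) (hGF : Function.RightInverse F G)
    (hFlat : LatticePeriodic fun x => torusCover (F x))
    (hGlat : LatticePeriodic fun x => torusCover (G x)) :
    ∃ Ψ : TorusAnalyticDiffeo, ∀ x, Ψ (torusCover x) = torusCover (F x) := by
  refine ⟨{ toFun := torusDescend fun x => torusCover (F x)
            invFun := torusDescend fun x => torusCover (G x)
            left_inv := fun z => ?_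
            right_inv := fun z => ?_
            contMDiff_toFun := contMDiff_torusDescend hFlat
              (contMDiff_torusCover.comp hF.contMDiff)
            contMDiff_invFun := contMDiff_torusDescend hGlat
              (contMDiff_torusCover.comp hG.contMDiff) }, fun x => torusDescend_torusCover hFlat x⟩
  · rw [← torusCover_torusSection 0 z, torusDescend_torusCover hFlat,
      torusDescend_torusCover hGlat, hGF]
  · rw [← torusCover_torusSection 0 z, torusDescend_torusCover hGlat,
      torusDescend_torusCover hFlat, hFG]

end Cover

/-! ### Lifting circle-valued maps to real functions. -/

section Lift

theorem exists_continuous_lift {f : ℝ × ℝ → Circle} (hf : Continuous f) :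
    ∃ m : ℝ × ℝ → ℝ, Continuous m ∧ ∀ x, Circle.exp (m x) = f x := by
  obtain ⟨F, ⟨-, hF⟩, -⟩ := Circle.isCoveringMap_exp.existsUnique_continuousMap_lifts
    (⟨f, hf⟩ : C(ℝ × ℝ, Circle)) 0 (Complex.arg (f 0)) (Circle.exp_arg _)
  exact ⟨F, F.continuous, fun x => congrFun hF x⟩

/-- By continuity `m` stays within `π` of `m x` near `x`, so there it is an analytic branch of the
logarithm of `f`. -/
theorem contDiff_of_circleExp_comp {f : ℝ × ℝ → Circle} {m : ℝ × ℝ → ℝ} (hm : Continuous m)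
    (hf : ContMDiff 𝓘(ℝ, ℝ × ℝ) (𝓡 1) ω f) (hmf : ∀ x, Circle.exp (m x) = f x) :
    ContDiff ℝ ω m := by
  refine contDiff_iff_contDiffAt.2 fun x => ?_
  have h1 : ContMDiffAt 𝓘(ℝ, ℝ × ℝ) 𝓘(ℝ, ℝ) ω (fun y => circleLog (m x) (f y)) x := by
    refine ContMDiffAt.comp x (g := circleLog (m x)) (I' := 𝓡 1) ?_ hf.contMDiffAt
    rw [← hmf]
    exact contMDiffAt_circleLog _
  refine h1.contDiffAt.congr_of_eventuallyEq ?_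
  have hc : Continuous fun y => |m y - m x| := (hm.sub continuous_const).abs
  have hev : ∀ᶠ y in 𝓝 x, |m y - m x| < Real.pi :=
    hc.continuousAt.eventually_lt continuousAt_const (by simpa using Real.pi_pos)
  filter_upwards [hev] with y hy
  rw [← hmf, circleLog_exp hy]

theorem exists_int_translation {m : ℝ × ℝ → ℝ} (hm : Continuous m) {v : ℝ × ℝ}
    (hv : ∀ x, Circle.exp (m (x + v)) = Circle.exp (m x)) :
    ∃ a : ℤ, ∀ x, m (x + v) = m x + 2 * Real.pi * a := by
  have hex : ∀ x, ∃ n : ℤ, m (x + v) = m x + n * (2 * Real.pi) := fun x =>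
    Circle.exp_eq_exp.1 (hv x)
  choose n hn using hex
  have hcont : Continuous n := by
    rw [Int.isClosedEmbedding_coe_real.continuous_iff]
    have : (Int.cast ∘ n : ℝ × ℝ → ℝ) = fun x => (m (x + v) - m x) / (2 * Real.pi) := by
      ext x
      have := Real.pi_ne_zero
      rw [hn x]
      simp only [Function.comp]
      field_simp
      ring
    rw [this]
    fun_prop
  refine ⟨n 0, fun x => ?_⟩
  rw [hn x, isPreconnected_univ.constant hcont.continuousOn (mem_univ x) (mem_univ 0)]
  ring

end Lift

/-! ### Unimodular changes of coordinates. -/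

/-- The unimodular change of coordinates with matrix `((p, -b), (q, a))`. -/
def shear (a b p q : ℤ) (x : ℝ × ℝ) : ℝ × ℝ := (p * x.1 - b * x.2, q * x.1 + a * x.2)

/-- The inverse of `shear a b p q` when `a * p + b * q = 1`. -/
def shearInv (a b p q : ℤ) (x : ℝ × ℝ) : ℝ × ℝ := (a * x.1 + b * x.2, -q * x.1 + p * x.2)

theorem contDiff_shear (a b p q : ℤ) : ContDiff ℝ ω (shear a b p q) := by
  unfold shear
  fun_prop

theorem contDiff_shearInv (a b p q : ℤ) : ContDiff ℝ ω (shearInv a b p q) := by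
  unfold shearInv
  fun_prop

theorem shear_add_latticePt (a b p q m n : ℤ) (x : ℝ × ℝ) :
    shear a b p q (x + latticePt m n) =
      shear a b p q x + latticePt (p * m - b * n) (q * m + a * n) := by
  ext <;> simp [shear, latticePt] <;> ring

theorem shearInv_add_latticePt (a b p q m n : ℤ) (x : ℝ × ℝ) :
    shearInv a b p q (x + latticePt m n) =
      shearInv a b p q x + latticePt (a * m + b * n) (-q * m + p * n) := by
  ext <;> simp [shearInv, latticePt] <;> ring

theorem shear_shearInv {a b p q : ℤ} (h : a * p + b * q = 1) (x : ℝ × ℝ) :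
    shear a b p q (shearInv a b p q x) = x := by
  have h' : (a * p + b * q : ℝ) = 1 := by exact_mod_cast h
  ext
  · simp only [shear, shearInv]
    linear_combination x.1 * h'
  · simp only [shear, shearInv]
    linear_combination x.2 * h'

theorem shearInv_shear {a b p q : ℤ} (h : a * p + b * q = 1) (x : ℝ × ℝ) :
    shearInv a b p q (shear a b p q x) = x := by
  have h' : (a * p + b * q : ℝ) = 1 := by exact_mod_cast h
  ext
  · simp only [shear, shearInv]
    linear_combination x.1 * h'
  · simp only [shear, shearInv]
    linear_combination x.2 * h'

/-! ### The integer class of a fibration. -/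

namespace IsAnalyticCircleFibration

variable {τ : Torus2 → Circle} {m : ℝ × ℝ → ℝ}

/-- As `τ` factors through `m` by a section analytic at the point, a zero of `dm` would make `dτ`
zero, against surjectivity onto a nonzero tangent space. -/
theorem fderiv_lift_ne_zero (hτ : IsAnalyticCircleFibration τ) (hm : ContDiff ℝ ω m)
    (hmτ : ∀ x, Circle.exp (m x) = τ (torusCover x)) (x : ℝ × ℝ) : fderiv ℝ m x ≠ 0 := by
  intro h0
  have hτeq : τ = Circle.exp ∘ (m ∘ torusSection x) := by
    ext z
    simp only [Function.comp, hmτ, torusCover_torusSection]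
  have hS : HasMFDerivAt ((𝓡 1).prod (𝓡 1)) 𝓘(ℝ, ℝ × ℝ) (torusSection x) (torusCover x) _ :=
    ((contMDiffAt_torusSection x).mdifferentiableAt (by simp)).hasMFDerivAt
  have hmd : HasMFDerivAt 𝓘(ℝ, ℝ × ℝ) 𝓘(ℝ, ℝ) m (torusSection x (torusCover x))
      (0 : ℝ × ℝ →L[ℝ] ℝ) := by
    rw [torusSection_torusCover, ← h0]
    exact (hm.differentiable (by simp) x).hasFDerivAt.hasMFDerivAt
  have hexp : HasMFDerivAt 𝓘(ℝ, ℝ) (𝓡 1) Circle.exp ((m ∘ torusSection x) (torusCover x)) _ :=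
    ((contMDiff_circleExp (m := ω)).contMDiffAt.mdifferentiableAt (by simp)).hasMFDerivAt
  have hcomp := (hexp.comp (torusCover x) (hmd.comp (torusCover x) hS)).mfderiv
  have hsurj := hτ.submersion (torusCover x)
  rw [hτeq, hcomp] at hsurj
  obtain ⟨v, hv⟩ := exists_ne (0 : EuclideanSpace ℝ (Fin 1))
  obtain ⟨u, hu⟩ := hsurj v
  exact hv (hu.symm.trans
    (map_zero (mfderiv 𝓘(ℝ, ℝ) (𝓡 1) Circle.exp ((m ∘ torusSection x) (torusCover x)))))

/-- The integers are the degrees of `τ` along the two coordinate circles. -/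
theorem exists_int_class (hm : Continuous m)
    (hmτ : ∀ x, Circle.exp (m x) = τ (torusCover x)) :
    ∃ a b : ℤ, LatticePeriodic fun x => m x - (a * x.1 + b * x.2) := by
  obtain ⟨a, ha⟩ := exists_int_translation hm (v := latticePt 1 0) fun x => by
    rw [hmτ, hmτ, torusCover_add_latticePt]
  obtain ⟨b, hb⟩ := exists_int_translation hm (v := latticePt 0 1) fun x => by
    rw [hmτ, hmτ, torusCover_add_latticePt]
  refine ⟨a, b, IsTwoPiPeriodic.latticePeriodic fun x y => ⟨?_, ?_⟩⟩
  · have := ha (x, y)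
    simp only [latticePt, Prod.mk_add_mk, Int.cast_one, Int.cast_zero, mul_one, mul_zero,
      add_zero] at this
    rw [this]
    ring
  · have := hb (x, y)
    simp only [latticePt, Prod.mk_add_mk, Int.cast_one, Int.cast_zero, mul_one, mul_zero,
      add_zero] at this
    rw [this]
    ring

/-- Otherwise `m` would be periodic and attain a maximum, a critical point. -/
theorem class_ne_zero {a b : ℤ} (hm : Continuous m) (hd : ∀ x, fderiv ℝ m x ≠ 0)
    (hper : LatticePeriodic fun x => m x - (a * x.1 + b * x.2)) : a ≠ 0 ∨ b ≠ 0 := by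
  by_contra hcon
  push Not at hcon
  obtain ⟨rfl, rfl⟩ := hcon
  obtain ⟨x0, -, h0⟩ := isCompact_fundSquare.exists_isMaxOn
    ⟨(0, 0), by constructor <;> simp [Real.pi_pos.le]⟩ hm.continuousOn
  refine hd x0 (IsLocalMax.fderiv_eq_zero (Eventually.of_forall fun x => ?_))
  obtain ⟨i, j, hij⟩ := exists_add_latticePt_mem x
  have h1 := hper i j x
  simp only [Int.cast_zero, zero_mul, add_zero, sub_zero] at h1
  rw [← h1]
  exact h0 hij

theorem surjective_lift {a b : ℤ} (hm : Continuous m) (hab : a ≠ 0 ∨ b ≠ 0)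
    (hper : LatticePeriodic fun x => m x - (a * x.1 + b * x.2)) : Function.Surjective m := by
  intro c
  obtain ⟨C, hC⟩ := hper.exists_norm_le (by fun_prop)
  have hN : (0 : ℝ) < (a : ℝ) ^ 2 + (b : ℝ) ^ 2 := by
    rcases hab with h | h
    · have : (a : ℝ) ≠ 0 := by exact_mod_cast h
      positivity
    · have : (b : ℝ) ≠ 0 := by exact_mod_cast h
      positivity
  -- The test point on the line spanned by `(a, b)` is where the linear part takes the value `t`.
  have key : ∀ t : ℝ, |m (t / (a ^ 2 + b ^ 2) * a, t / (a ^ 2 + b ^ 2) * b) - t| ≤ C := fun t => by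
    have := hC (t / (a ^ 2 + b ^ 2) * a, t / (a ^ 2 + b ^ 2) * b)
    rw [Real.norm_eq_abs] at this
    convert this using 3
    field_simp
  refine mem_range_of_exists_le_of_exists_ge hm
    ⟨((c - C) / (a ^ 2 + b ^ 2) * a, (c - C) / (a ^ 2 + b ^ 2) * b), ?_⟩
    ⟨((c + C) / (a ^ 2 + b ^ 2) * a, (c + C) / (a ^ 2 + b ^ 2) * b), ?_⟩
  · linarith [(abs_le.1 (key (c - C))).2]
  · linarith [(abs_le.1 (key (c + C))).1]

theorem finite_circle_pow_eq_one {d : ℕ} (hd : 0 < d) : {w : Circle | w ^ d = 1}.Finite := by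
  have h1 : {z : ℂ | z ^ d = 1}.Finite := by
    refine (Polynomial.nthRootsFinset d (1 : ℂ)).finite_toSet.subset fun z hz => ?_
    exact (Polynomial.mem_nthRootsFinset hd 1).2 hz
  refine (h1.preimage (f := fun w : Circle => (w : ℂ)) Subtype.coe_injective.injOn).subset
    fun w hw => ?_
  have : ((w ^ d : Circle) : ℂ) = 1 := by rw [show w ^ d = 1 from hw]; rfl
  simpa using this

/-- Connectedness of the fibres forces the homotopy class of the fibration to be primitive. -/
theorem gcd_class_eq_one (hτ : IsAnalyticCircleFibration τ) {a b : ℤ} (hm : Continuous m)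
    (hmτ : ∀ x, Circle.exp (m x) = τ (torusCover x)) (hab : a ≠ 0 ∨ b ≠ 0)
    (hper : LatticePeriodic fun x => m x - (a * x.1 + b * x.2)) : Int.gcd a b = 1 := by
  set d := Int.gcd a b
  have hd0 : 0 < d := Int.gcd_pos_iff.2 hab
  have hdR : (d : ℝ) ≠ 0 := by exact_mod_cast hd0.ne'
  obtain ⟨a', ha'⟩ : (d : ℤ) ∣ a := Int.gcd_dvd_left ..
  obtain ⟨b', hb'⟩ : (d : ℤ) ∣ b := Int.gcd_dvd_right ..
  -- Since `d` divides both `a` and `b`, this `d`-th root of `τ` descends to the torus.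
  have hσper : LatticePeriodic fun x => Circle.exp (m x / d) := fun i j x => by
    have h1 := hper i j x
    simp only [latticePt, Prod.fst_add, Prod.snd_add] at h1
    have h2 : m (x + latticePt i j) / d = m x / d + 2 * Real.pi * ((a' * i + b' * j : ℤ) : ℝ) := by
      have ea : (a : ℝ) = d * a' := by exact_mod_cast ha'
      have eb : (b : ℝ) = d * b' := by exact_mod_cast hb'
      rw [latticePt, eq_add_of_sub_eq h1, ea, eb]
      push_cast
      field_simp
      ring
    simp only [h2, circleExp_add_two_pi_mul_int]
  have hσc := continuous_torusDescend hσper (by fun_prop)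
  set σ := torusDescend fun x => Circle.exp (m x / d)
  have hσ : ∀ x, σ (torusCover x) = Circle.exp (m x / d) := torusDescend_torusCover hσper
  have hpow : ∀ z, σ z ^ d = τ z := fun z => by
    rw [← torusCover_torusSection 0 z, hσ, ← hmτ, ← Circle.exp_nsmul]
    congr 1
    rw [nsmul_eq_mul]
    field_simp
  obtain ⟨x0, h0⟩ := surjective_lift hm hab hper 0
  obtain ⟨x1, h1⟩ := surjective_lift hm hab hper (2 * Real.pi)
  -- On the fibre over `1` the root takes values in the finite set of `d`-th roots of unity, so it
  -- is constant there. The lift values `0` and `2π` both lie over this fibre, whence `exp (2πi/d) =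
  -- 1`.
  have heq := (hτ.connected_fibre 1).isPreconnected.constant_of_mapsTo
    (finite_circle_pow_eq_one hd0).isDiscrete hσc.continuousOn
    (fun z hz => (hpow z).trans hz)
    (x := torusCover x0) (y := torusCover x1)
    ((hmτ x0).symm.trans (by rw [h0, Circle.exp_zero]))
    ((hmτ x1).symm.trans (by rw [h1, Circle.exp_two_pi]))
  rw [hσ, hσ, h0, h1, Circle.exp_eq_exp] at heq
  obtain ⟨n, hn⟩ := heq
  have h3 : (-1 : ℝ) = n * d := by
    have := Real.pi_ne_zero
    field_simp at hn
    have := (mul_eq_zero.1 hn.symm).resolve_left (by positivity)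
    linarith
  have h4 : (d : ℤ) ∣ 1 := ⟨-n, by
    have : (-1 : ℤ) = n * d := by exact_mod_cast h3
    linarith⟩
  exact_mod_cast Int.eq_one_of_dvd_one (by positivity) h4

end IsAnalyticCircleFibration

/-! ### Trivialising a fibration and the final assembly. -/

theorem exists_torus_trivialisation {τ : Torus2 → Circle} (hτ : IsAnalyticCircleFibration τ) :
    ∃ Ψ : TorusAnalyticDiffeo, ∀ z : Torus2, τ (Ψ z) = z.1 := by
  have hcover : ContMDiff 𝓘(ℝ, ℝ × ℝ) (𝓡 1) ω fun x => τ (torusCover x) :=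
    hτ.analytic.comp contMDiff_torusCover
  obtain ⟨m, hmc, hmτ⟩ := exists_continuous_lift hcover.continuous
  have hman := contDiff_of_circleExp_comp hmc hcover hmτ
  have hmd := hτ.fderiv_lift_ne_zero hman hmτ
  obtain ⟨a, b, hper⟩ := IsAnalyticCircleFibration.exists_int_class hmc hmτ
  have hab := IsAnalyticCircleFibration.class_ne_zero hmc hmd hper
  have hgcd := hτ.gcd_class_eq_one hmc hmτ hab hper
  obtain ⟨p, q, hpq⟩ : ∃ p q : ℤ, a * p + b * q = 1 :=
    ⟨Int.gcdA a b, Int.gcdB a b, by rw [← Int.gcd_eq_gcd_ab, hgcd]; rfl⟩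
  have hpqR : (a * p + b * q : ℝ) = 1 := by exact_mod_cast hpq
  -- The Bézout relation makes the linear part `a θ₁ + b θ₂` of `m` become the first coordinate
  -- after the shear.
  have hsub : IsPeriodicSubmersion fun x => m (shear a b p q x) :=
    { contDiff := hman.comp (contDiff_shear a b p q)
      periodic := fun i j x => by
        have h1 := hper (p * i - b * j) (q * i + a * j) (shear a b p q x)
        rw [← shear_add_latticePt] at h1
        have e : ∀ y : ℝ × ℝ, a * (shear a b p q y).1 + b * (shear a b p q y).2 = y.1 := fun y => by
          simp only [shear]
          linear_combination y.1 * hpqR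
        simpa only [e] using h1
      fderiv_ne_zero := fun x h0 => by
        apply hmd (shear a b p q x)
        have e : m = (fun y => m (shear a b p q y)) ∘ shearInv a b p q := by
          ext y
          simp only [Function.comp, shear_shearInv hpq]
        rw [e, fderiv_comp]
        · rw [shearInv_shear hpq, h0, ContinuousLinearMap.zero_comp]
        · exact (hman.comp (contDiff_shear a b p q)).differentiable (by simp) _
        · exact (contDiff_shearInv a b p q).differentiable (by simp) _ }
  obtain ⟨F, G, hF, hG, hFG, hGF, hFlat, hGlat, hμ⟩ := hsub.exists_straightening
  obtain ⟨Ψ, hΨ⟩ := exists_torusAnalyticDiffeo (F := shear a b p q ∘ F) (G := G ∘ shearInv a b p q)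
    ((contDiff_shear a b p q).comp hF) (hG.comp (contDiff_shearInv a b p q))
    (fun x => by simp only [Function.comp, hFG (shearInv a b p q x), shear_shearInv hpq])
    (fun x => by simp only [Function.comp, shearInv_shear hpq, hGF x])
    (fun i j x => by
      simp only [Function.comp, hFlat, shear_add_latticePt, torusCover_add_latticePt])
    (fun i j x => by
      simp only [Function.comp, hGlat, shearInv_add_latticePt, torusCover_add_latticePt])
  refine ⟨Ψ, fun z => ?_⟩
  rw [← torusCover_torusSection 0 z, hΨ, ← hmτ]
  simp only [Function.comp, hμ]
  rfl

theorem proposition2p1 :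
    (∀ h : ℝ × ℝ → ℝ,
      AnalyticOnNhd ℝ h Set.univ →
      IsTwoPiPeriodic h →
      (∀ θ : ℝ × ℝ, fderiv ℝ (fun p : ℝ × ℝ => p.1 + h p) θ ≠ 0) →
      ∃ Ψ : TorusAnalyticDiffeo, ∃ F : ℝ × ℝ → ℝ × ℝ,
        IsTorusLifting F Ψ ∧ ∀ θ : ℝ × ℝ, (F θ).1 + h (F θ) = θ.1) ∧
    (∀ τ : Torus2 → Circle,
      IsAnalyticCircleFibration τ →
      ∃ Ψ : TorusAnalyticDiffeo, ∀ z : Torus2, τ (Ψ z) = z.1) := by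
  refine ⟨fun h han hper hd => ?_, fun τ hτ => exists_torus_trivialisation hτ⟩
  have hsub : IsPeriodicSubmersion fun p : ℝ × ℝ => p.1 + h p :=
    { contDiff := contDiff_fst.add (contDiffOn_univ.1 (han.contDiffOn uniqueDiffOn_univ))
      periodic := by simpa only [add_sub_cancel_left] using hper.latticePeriodic
      fderiv_ne_zero := hd }
  obtain ⟨F, G, hF, hG, hFG, hGF, hFlat, hGlat, hμ⟩ := hsub.exists_straightening
  obtain ⟨Ψ, hΨ⟩ := exists_torusAnalyticDiffeo hF hG hFG hGF
    (fun i j x => by simp only [hFlat, torusCover_add_latticePt])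
    (fun i j x => by simp only [hGlat, torusCover_add_latticePt])
  exact ⟨Ψ, F, ⟨hF.continuous, fun θ => (hΨ θ).symm⟩, hμ⟩
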